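/- For a finite graph $G$ with $n$ vertices and adjacency eigenvalues $\lambda_1,\dots,\lambda_n$ (with multiplicity), let $M_k(G)=\lambda_1^k+\dots+\lambda_n^k$ be its $k$-th spectral moment. A leaf is a vertex of degree $1$. A tree with a chosen root is a \emph{level greedy tree} if, for every $h\ge 0$, the vertices at distance $h$ from the root can be ordered so that their degrees are non-increasing and so that the children of the vertices at distance $h$, listed in this order (first all children of the first vertex, then all children of the second one, and so on), form consecutive blocks of the ordered list of the vertices at distance $h+1$. A tree is a \emph{greedy tree} if a root can be chosen so that it becomes a level greedy tree in which, for every $h\ge 0$, every vertex at distance $h$ from the root has degree at least that of every vertex at distance $h+1$. Let $n$ and $s$ be integers with $0\le s\le n-1$ such that there is a tree with $n$ vertices and $s$ leaves (that is, $2\le s\le n-1$, or $n=1$ and $s=0$). Then there is a greedy tree with degree sequence $(s,2,\dots,2,1,\dots,1)$, where after the first term $s$ there are $n-s-1$ terms equal to $2$ and $s$ terms equal to $1$. Every such greedy tree $G$ has $n$ vertices and $s$ leaves, and for every tree $T$ with $n$ vertices and $s$ leaves and every integer $k\ge 0$, $$M_k(T)\le M_k(G).$$ -/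

import Mathlib

namespace GreedyTrees

open Classical in
/-- The `k`-th spectral moment `M_k(G) = λ₁ ^ k + ⋯ + λₙ ^ k`, where `λ₁, …, λₙ` are the eigenvalues
(with multiplicity) of the adjacency matrix of `G`. -/
noncomputable def spectralMoment {V : Type*} [Fintype V] (k : ℕ) (G : SimpleGraph V) : ℝ :=
  ∑ i : V, (G.isHermitian_adjMatrix ℝ).eigenvalues i ^ k

open Classical in
/-- The degree sequence of `G`, as a multiset (that is, up to the order of its terms). -/
noncomputable def degreeSequence {V : Type*} [Fintype V] (G : SimpleGraph V) : Multiset ℕ :=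
  (Finset.univ : Finset V).val.map fun v => G.degree v

open Classical in
/-- The number of leaves of `G`: vertices of degree one. -/
noncomputable def numLeaves {V : Type*} [Fintype V] (G : SimpleGraph V) : ℕ :=
  (Finset.univ.filter fun v : V => G.degree v = 1).card

open Classical in
/-- The vertices of the rooted tree `(G, r)` at distance `h` from the root `r`. -/
noncomputable def level {V : Type*} [Fintype V] (G : SimpleGraph V) (r : V) (h : ℕ) : Finset V :=
  Finset.univ.filter fun v => G.dist r v = h

open Classical in
/-- The number of children of `v` in the rooted tree `(G, r)`, i.e. of neighbours of `v` at the next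
level: `deg v` if `v = r`, and `deg v - 1` otherwise. -/
noncomputable def numChildren {V : Type*} [Fintype V] (G : SimpleGraph V) (r v : V) : ℕ :=
  ((level G r (G.dist r v + 1)).filter fun w => G.Adj v w).card

open Classical in
/-- The number of children of all the vertices that come before `v` at the level of `v`, when every
level is ordered by the labels `pos`. -/
noncomputable def childrenBefore {V : Type*} [Fintype V] (G : SimpleGraph V) (r : V) (pos : V → ℕ)
    (v : V) : ℕ :=
  ∑ u ∈ (level G r (G.dist r v)).filter (fun u => pos u < pos v), numChildren G r u

open Classical in
/-- The tree `G` with root `r` is a level greedy tree, the labelling of its levels being `pos`: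
* the `m` vertices of each level are labelled `0, …, m - 1`;
* the degrees are non-increasing along each level;
* going through the vertices of a level in order, each of them receives as its children the next
  unused vertices of the next level, as many as its degree asks for. -/
structure IsLevelGreedyLabelling {V : Type*} [Fintype V] (G : SimpleGraph V) (r : V)
    (pos : V → ℕ) : Prop where
  isTree : G.IsTree
  bijOn : ∀ h : ℕ, Set.BijOn pos (level G r h) (Set.Iio (level G r h).card)
  degree_antitone : ∀ u v : V, G.dist r u = G.dist r v → pos u ≤ pos v → G.degree v ≤ G.degree u
  adj_iff : ∀ v w : V, G.dist r w = G.dist r v + 1 →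
    (G.Adj v w ↔ childrenBefore G r pos v ≤ pos w ∧
      pos w < childrenBefore G r pos v + numChildren G r v)

/-- The tree `G` with root `r` is a level greedy tree. -/
def IsLevelGreedyTree {V : Type*} [Fintype V] (G : SimpleGraph V) (r : V) : Prop :=
  ∃ pos : V → ℕ, IsLevelGreedyLabelling G r pos

open Classical in
/-- `G` is a greedy tree: for a suitable root `r` it is a level greedy tree, and the smallest degree
at each level is at least the largest degree at the next level. -/
def IsGreedyTree {V : Type*} [Fintype V] (G : SimpleGraph V) : Prop :=
  ∃ r : V, IsLevelGreedyTree G r ∧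
    ∀ u v : V, G.dist r v = G.dist r u + 1 → G.degree v ≤ G.degree u

/-- The degree sequence `(s, 2, …, 2, 1, …, 1)` with `n - s - 1` twos and `s` ones after the first
term `s` (meant for `s < n`). -/
def leafSequence (n s : ℕ) : List ℕ :=
  s :: (List.replicate (n - s - 1) 2 ++ List.replicate s 1)

end GreedyTrees

set_option linter.unusedSectionVars false

namespace GreedyTrees

open Matrix

/-! ### Walk counts as entries of powers of natural-number matrices -/

section MatrixLemmas

variable {V ι : Type*} [Fintype V] [DecidableEq V] [Fintype ι]

/-! `M_k` is the trace of the `k`-th power of the adjacency matrix, so it counts closed walks of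
length `k`. Everything rests on one surgery, `shift`: on a path `x 0, …, x N` with `2 * b + m ≤ N`,
where among the vertices before `x (b + m)` only `x b` may have neighbours off the path, the
branches at `x b` are moved to `x (b + m)`. With these branches detached, the reflection `i ↦ 2 * b
+ m - i` turns closed walks at `x b` avoiding `x (b + m)` into closed walks at `x (b + m)` avoiding
`x b`. Decomposing walks at their passages between the two vertices gives at least as many closed
walks at `x (b + m)` as at `x b` (`IsShiftable.pow_apply_self_le`). Hanging the same branches at a
vertex with more closed walks lowers no moment (`spectralMoment_attach_le`). The surgery keeps the
tree property and the number of leaves.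

It is used twice. Two branching vertices lie on a common leaf-to-leaf path, and shifting the one
nearest to an end leaves one branching vertex fewer; iterating yields a spider
(`exists_subsingleton_branching`). In a spider with leg lengths differing by at least two, a shift
with `m = 1` moves the centre one step into the longest leg and lowers the sum of distances from the
centre (`IsSpider.exists_balance`); iterating yields a balanced spider.

A balanced spider is determined up to isomorphism by its order and the degree of its centre
(`IsLegIndex.nonempty_iso`), and that degree, when it is not one, is the number of leaves. Finally,
balanced spiders are greedy trees (`IsBalancedSpider.isGreedyTree`), and a greedy tree with the
prescribed degrees is a balanced spider (`exists_isBalancedSpider_of_isGreedyTree`). -/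

theorem bilinear_pow_le (D : Matrix V V ℕ) (E E' : Matrix V ι ℕ) (J : Matrix ι ι ℕ)
    (h : ∀ (i : ℕ) (a b : ι), (Eᵀ * D ^ i * E) a b ≤ (E'ᵀ * D ^ i * E') a b) (j : ℕ) :
    ∀ (i : ℕ) (a b : ι), (Eᵀ * ((D + E * J * Eᵀ) ^ j * D ^ i) * E) a b ≤
      (E'ᵀ * ((D + E' * J * E'ᵀ) ^ j * D ^ i) * E') a b := by
  induction j with
  | zero => simpa using h
  | succ j ih =>
    -- Splitting off the last factor, `D` is absorbed into `D ^ i` (hence the extra exponent), while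
    -- `F * J * Fᵀ` cuts the product into two compressions by `F`.
    have key : ∀ (F : Matrix V ι ℕ) (i : ℕ), Fᵀ * ((D + F * J * Fᵀ) ^ (j + 1) * D ^ i) * F =
        Fᵀ * ((D + F * J * Fᵀ) ^ j * D ^ (i + 1)) * F +
          (Fᵀ * ((D + F * J * Fᵀ) ^ j * D ^ 0) * F) * J * (Fᵀ * D ^ i * F) := by
      intro F i
      rw [pow_succ, pow_succ' D i]
      simp only [Matrix.mul_add, Matrix.add_mul, Matrix.mul_assoc, pow_zero, Matrix.one_mul]
    intro i a b
    rw [key, key, Matrix.add_apply, Matrix.add_apply]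
    refine Nat.add_le_add (ih _ _ _) ?_
    simp only [Matrix.mul_apply (M := _ * J), Matrix.mul_apply (N := J)]
    exact Finset.sum_le_sum fun c _ => Nat.mul_le_mul
      (Finset.sum_le_sum fun d _ => Nat.mul_le_mul (ih _ _ _) le_rfl) (h _ _ _)

/-- Once expanded, the trace depends on `E` only through the compressions `Eᵀ * D ^ i * E`, and
monotonically, since all entries are natural numbers. -/
theorem trace_pow_le {D : Matrix V V ℕ} (hD : D.IsSymm) (E E' : Matrix V ι ℕ) {J : Matrix ι ι ℕ}
    (hJ : J.IsSymm) (h : ∀ (i : ℕ) (a b : ι), (Eᵀ * D ^ i * E) a b ≤ (E'ᵀ * D ^ i * E') a b) (k : ℕ) :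
    ((D + E * J * Eᵀ) ^ k).trace ≤ ((D + E' * J * E'ᵀ) ^ k).trace := by
  suffices H : ∀ j i, ((D + E * J * Eᵀ) ^ j * D ^ i).trace ≤
      ((D + E' * J * E'ᵀ) ^ j * D ^ i).trace by simpa using H k 0
  intro j
  induction j with
  | zero => simp
  | succ j ih =>
    intro i
    have key : ∀ F : Matrix V ι ℕ, ((D + F * J * Fᵀ) ^ (j + 1) * D ^ i).trace =
        ((D + F * J * Fᵀ) ^ j * D ^ (i + 1)).trace +
          (J * (Fᵀ * ((D + F * J * Fᵀ) ^ j * D ^ i) * F)).trace := by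
      intro F
      rw [pow_succ, pow_succ' D i, Matrix.mul_assoc, Matrix.add_mul, Matrix.mul_add,
        Matrix.trace_add]
      congr 1
      have h1 : ((D + F * J * Fᵀ) ^ j * (F * J * Fᵀ * D ^ i)).trace =
          (J * (Fᵀ * (D ^ i * (D + F * J * Fᵀ) ^ j) * F)).trace := by
        have : (D + F * J * Fᵀ) ^ j * (F * J * Fᵀ * D ^ i) =
          ((D + F * J * Fᵀ) ^ j * F) * (J * (Fᵀ * D ^ i)) := by simp only [Matrix.mul_assoc]
        rw [this, Matrix.trace_mul_comm]
        simp only [Matrix.mul_assoc]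
      -- Cyclicity has put `D ^ i` on the wrong side of the power; transposing repairs this, as `D`
      -- and `J` are symmetric.
      rw [h1, ← Matrix.trace_transpose (J * _), Matrix.transpose_mul, Matrix.trace_mul_comm]
      simp [Matrix.transpose_mul, Matrix.transpose_pow, hD.eq, hJ.eq, Matrix.mul_assoc]
    rw [key, key]
    refine Nat.add_le_add (ih _) ?_
    simp only [Matrix.trace, Matrix.diag, Matrix.mul_apply (M := J)]
    exact Finset.sum_le_sum fun c _ => Finset.sum_le_sum fun d _ =>
      Nat.mul_le_mul le_rfl (bilinear_pow_le D E E' J h _ _ _ _)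

/-- The matrix `D` with the row and the column of `u` set to zero. -/
def deleteVertex (D : Matrix V V ℕ) (u : V) : Matrix V V ℕ :=
  Matrix.of fun i j => if i = u ∨ j = u then 0 else D i j

theorem deleteVertex_pow_apply (D : Matrix V V ℕ) {u v : V} (h : v ≠ u) (j : ℕ) :
    (deleteVertex D u ^ j) v u = 0 := by
  cases j with
  | zero => simp [h]
  | succ j =>
    rw [pow_succ, Matrix.mul_apply]
    exact Finset.sum_eq_zero fun w _ => by simp [deleteVertex]

/-- Walks are sorted by their first visit to `u`: `a` steps avoiding `u`, one step into `u`, then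
any walk with the remaining `j - 1 - a` steps. -/
theorem pow_apply_eq_first_passage (D : Matrix V V ℕ) {u v : V} (h : v ≠ u) (y : V) (j : ℕ) :
    (D ^ j) v y = (deleteVertex D u ^ j) v y +
      ∑ a ∈ Finset.range j, (deleteVertex D u ^ a * D) v u * (D ^ (j - 1 - a)) u y := by
  set B := deleteVertex D u with hB
  set C : Matrix V V ℕ := Matrix.of fun i k => if i = u ∨ k = u then D i k else 0 with hC
  have hDBC : D = B + C := by
    ext i k
    simp only [hB, hC, deleteVertex, Matrix.add_apply, Matrix.of_apply]
    split_ifs <;> simp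
  have tel : ∀ j, D ^ j = B ^ j + ∑ a ∈ Finset.range j, B ^ a * (C * D ^ (j - 1 - a)) := by
    intro j
    induction j with
    | zero => simp
    | succ j ih =>
      rw [Finset.sum_range_succ']
      have h1 : D ^ (j + 1) = B * D ^ j + C * D ^ j := by rw [pow_succ', ← Matrix.add_mul, ← hDBC]
      rw [h1]
      conv_lhs => rw [ih]
      rw [Matrix.mul_add, ← pow_succ', Finset.mul_sum, ← ih, add_assoc]
      congr 1
      simp only [pow_zero, Matrix.one_mul, add_tsub_cancel_right, tsub_zero]
      congr 1
      refine Finset.sum_congr rfl fun a ha => ?_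
      rw [← Matrix.mul_assoc, ← pow_succ', show j - (a + 1) = j - 1 - a by omega]
  have hBu : ∀ a, (B ^ a) v u = 0 := deleteVertex_pow_apply D h
  conv_lhs => rw [tel j]
  rw [Matrix.add_apply, Matrix.sum_apply]
  congr 1
  refine Finset.sum_congr rfl fun a _ => ?_
  have hBC : ∀ z, (B ^ a * C) v z = if z = u then (B ^ a * D) v u else 0 := by
    intro z
    rw [Matrix.mul_apply]
    split_ifs with hz
    · subst hz
      rw [Matrix.mul_apply]
      exact Finset.sum_congr rfl fun w _ => by simp [hC]
    · refine Finset.sum_eq_zero fun w _ => ?_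
      by_cases hw : w = u
      · rw [hw, hBu, zero_mul]
      · simp [hC, hw, hz]
  rw [← Matrix.mul_assoc, Matrix.mul_apply]
  simp [hBC]

/-- If there are at least as many closed walks at `u` avoiding `v` as at `v` avoiding `u`, then there
are at least as many closed walks at `u` as at `v`. -/
theorem pow_apply_self_le (D : Matrix V V ℕ) {u v : V} (h : v ≠ u)
    (hle : ∀ i, (deleteVertex D u ^ i) v v ≤ (deleteVertex D v ^ i) u u) (j : ℕ) :
    (D ^ j) v v ≤ (D ^ j) u u := by
  -- A closed walk at `v` meeting `u` is a first passage to `u`, a first passage back to `v`, and a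
  -- closed walk at `v`.
  have hv : ∀ j, (D ^ j) v v = (deleteVertex D u ^ j) v v + ∑ a ∈ Finset.range j,
      ∑ c ∈ Finset.range (j - 1 - a), ((deleteVertex D u ^ a * D) v u *
        (deleteVertex D v ^ c * D) u v) * (D ^ (j - 1 - a - 1 - c)) v v := by
    intro j
    rw [pow_apply_eq_first_passage D h v j]
    congr 1
    refine Finset.sum_congr rfl fun a _ => ?_
    rw [pow_apply_eq_first_passage D h.symm v, deleteVertex_pow_apply D h.symm, zero_add,
      Finset.mul_sum]
    simp only [mul_assoc]
  have swap : ∀ (j : ℕ) (F : ℕ → ℕ → ℕ),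
      ∑ a ∈ Finset.range j, ∑ c ∈ Finset.range (j - 1 - a), F a c =
      ∑ c ∈ Finset.range j, ∑ a ∈ Finset.range (j - 1 - c), F a c := by
    intro j F
    refine Finset.sum_comm' fun a c => ?_
    simp only [Finset.mem_range]
    omega
  -- From `u` the two passages occur in the opposite order; after exchanging the sums the
  -- coefficients match those of `hv`, so induction applies term by term.
  have hu : ∀ j, (D ^ j) u u = (deleteVertex D v ^ j) u u + ∑ a ∈ Finset.range j,
      ∑ c ∈ Finset.range (j - 1 - a), ((deleteVertex D u ^ a * D) v u *
        (deleteVertex D v ^ c * D) u v) * (D ^ (j - 1 - a - 1 - c)) u u := by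
    intro j
    rw [pow_apply_eq_first_passage D h.symm u j, swap]
    congr 1
    refine Finset.sum_congr rfl fun a _ => ?_
    rw [pow_apply_eq_first_passage D h u, deleteVertex_pow_apply D h, zero_add,
      Finset.mul_sum]
    refine Finset.sum_congr rfl fun c _ => ?_
    rw [show j - 1 - c - 1 - a = j - 1 - a - 1 - c by omega]
    ring
  induction j using Nat.strong_induction_on with
  | _ j ih =>
    rw [hv, hu]
    refine Nat.add_le_add (hle j) (Finset.sum_le_sum fun a ha => Finset.sum_le_sum fun c hc =>
      Nat.mul_le_mul le_rfl (ih _ ?_))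
    simp only [Finset.mem_range] at ha hc
    omega

/-- Walk counts do not decrease along a map that is injective on a union of components. -/
theorem pow_apply_le_of_injOn (A B : Matrix V V ℕ) (S : Finset V) (φ : V → V)
    (hS : ∀ x ∈ S, ∀ y, A x y ≠ 0 → y ∈ S) (hφ : Set.InjOn φ S)
    (hAB : ∀ x ∈ S, ∀ y ∈ S, A x y ≤ B (φ x) (φ y)) (i : ℕ) :
    ∀ x ∈ S, ∀ y ∈ S, (A ^ i) x y ≤ (B ^ i) (φ x) (φ y) := by
  induction i with
  | zero =>
    intro x _ y _
    by_cases hxy : x = y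
    · simp [hxy]
    · simp [Matrix.one_apply_ne hxy]
  | succ i ih =>
    intro x hx y hy
    rw [pow_succ', pow_succ', Matrix.mul_apply, Matrix.mul_apply]
    calc ∑ z, A x z * (A ^ i) z y = ∑ z ∈ S, A x z * (A ^ i) z y := by
          refine (Finset.sum_subset (Finset.subset_univ S) fun z _ hz => ?_).symm
          have : A x z = 0 := by
            by_contra h0
            exact hz (hS x hx z h0)
          rw [this, zero_mul]
      _ ≤ ∑ z ∈ S, B (φ x) (φ z) * (B ^ i) (φ z) (φ y) :=
          Finset.sum_le_sum fun z hz => Nat.mul_le_mul (hAB x hx z hz) (ih z hz y hy)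
      _ = ∑ z ∈ S.image φ, B (φ x) z * (B ^ i) z (φ y) := by
          rw [Finset.sum_image hφ]
      _ ≤ ∑ z, B (φ x) z * (B ^ i) z (φ y) :=
          Finset.sum_le_sum_of_subset (Finset.subset_univ _)

end MatrixLemmas

/-! ### Spectral moments as traces -/

section Moments

open scoped Classical

variable {V : Type*} [Fintype V]

theorem sum_eigenvalues_pow {A : Matrix V V ℝ} (hA : A.IsHermitian) (k : ℕ) :
    ∑ i, hA.eigenvalues i ^ k = (A ^ k).trace := by
  have h := congrArg (fun M => M ^ k) hA.spectral_theorem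
  simp only [← map_pow, Matrix.diagonal_pow] at h
  rw [h, Unitary.conjStarAlgAut_apply, Matrix.trace_mul_cycle, Unitary.coe_star_mul_self,
    Matrix.one_mul, Matrix.trace_diagonal]
  simp

theorem spectralMoment_eq_trace (k : ℕ) (G : SimpleGraph V) :
    spectralMoment k G = (((G.adjMatrix ℕ) ^ k).trace : ℕ) := by
  have h : G.adjMatrix ℝ = (G.adjMatrix ℕ).map (Nat.castRingHom ℝ) := by
    ext i j
    simp [SimpleGraph.adjMatrix_apply]
  rw [spectralMoment, sum_eigenvalues_pow, h, ← Matrix.map_pow]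
  simp [Matrix.trace]

theorem spectralMoment_congr {W : Type*} [Fintype W] {G : SimpleGraph V} {H : SimpleGraph W}
    (e : G ≃g H) (k : ℕ) : spectralMoment k G = spectralMoment k H := by
  rw [spectralMoment_eq_trace, spectralMoment_eq_trace, ← e.reindex_adjMatrix ℕ]
  have key : ∀ f : V ≃ W, ((Matrix.reindex f f (G.adjMatrix ℕ)) ^ k).trace =
      (G.adjMatrix ℕ ^ k).trace := by
    intro f
    have : (Matrix.reindex f f (G.adjMatrix ℕ)) ^ k = Matrix.reindex f f (G.adjMatrix ℕ ^ k) := by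
      rw [← Matrix.coe_reindexAlgEquiv ℕ ℕ, map_pow]
    rw [this]
    simp only [Matrix.trace, Matrix.diag, Matrix.reindex_apply, Matrix.submatrix_apply]
    rw [← Equiv.sum_comp f]
    simp only [Equiv.symm_apply_apply]
  rw [key]

end Moments

/-! ### Attaching branches to a vertex -/

section Attach

open scoped Classical

variable {V : Type*} [Fintype V]

/-- The graph `H` together with all the edges from `z` to a vertex of `R`. -/
def attach (H : SimpleGraph V) (z : V) (R : Finset V) : SimpleGraph V where
  Adj a c := H.Adj a c ∨ (a = z ∧ c ∈ R ∧ c ≠ z) ∨ (c = z ∧ a ∈ R ∧ a ≠ z)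
  symm := ⟨fun a c h => by
    rcases h with h | h | h
    · exact Or.inl h.symm
    · exact Or.inr (Or.inr h)
    · exact Or.inr (Or.inl h)⟩
  loopless := ⟨fun a h => by
    rcases h with h | h | h
    · exact H.loopless.irrefl a h
    · exact h.2.2 h.1
    · exact h.2.2 h.1⟩

theorem attach_adj {H : SimpleGraph V} {z a c : V} {R : Finset V} : (attach H z R).Adj a c ↔
    H.Adj a c ∨ (a = z ∧ c ∈ R ∧ c ≠ z) ∨ (c = z ∧ a ∈ R ∧ a ≠ z) := Iff.rfl

variable {H : SimpleGraph V} {z : V} {R : Finset V}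

theorem adjMatrix_attach_apply (h : ∀ r ∈ R, ¬ H.Reachable z r) (a c : V) :
    (attach H z R).adjMatrix ℕ a c = H.adjMatrix ℕ a c +
      (if a = z then if c ∈ R then 1 else 0 else 0) +
      (if a ∈ R then if c = z then 1 else 0 else 0) := by
  have hz : z ∉ R := fun hz => h z hz (SimpleGraph.Reachable.refl z)
  simp only [SimpleGraph.adjMatrix_apply, attach_adj]
  by_cases haz : a = z
  · subst haz
    by_cases hc : c ∈ R
    · have h1 : ¬ H.Adj a c := fun h2 => h c hc h2.reachable
      have h3 : c ≠ a := fun h4 => hz (h4 ▸ hc)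
      simp [h1, hc, hz, h3]
    · simp [hc, hz]
  · by_cases hcz : c = z
    · subst hcz
      by_cases ha : a ∈ R
      · have h1 : ¬ H.Adj a c := fun h2 => h a ha h2.symm.reachable
        simp [h1, ha, haz]
      · simp [ha, haz]
    · simp [haz, hcz]

theorem degree_attach (h : ∀ r ∈ R, ¬ H.Reachable z r) (a : V) :
    (attach H z R).degree a = H.degree a + (if a = z then R.card else 0) +
      (if a ∈ R then 1 else 0) := by
  have hdeg : ∀ (G : SimpleGraph V), G.degree a = ∑ c, G.adjMatrix ℕ a c := by
    intro G
    simp [SimpleGraph.adjMatrix_apply, ← SimpleGraph.card_neighborFinset_eq_degree,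
      SimpleGraph.neighborFinset_eq_filter]
  rw [hdeg, hdeg, Finset.sum_congr rfl fun c _ => adjMatrix_attach_apply h a c,
    Finset.sum_add_distrib, Finset.sum_add_distrib]
  congr 1
  · congr 1
    split_ifs <;> simp
  · split_ifs <;> simp

/-- The new edges are an update `E * J * Eᵀ`, the columns of `E` being the indicators of the
attaching vertex and of `R`. In the compressions the mixed entries vanish by unreachability, the
entry for `R` ignores the attaching vertex, and the last one counts closed walks there. -/
theorem spectralMoment_attach_le {u v : V} (hv : ∀ r ∈ R, ¬ H.Reachable v r)
    (hu : ∀ r ∈ R, ¬ H.Reachable u r)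
    (hle : ∀ i, (H.adjMatrix ℕ ^ i) v v ≤ (H.adjMatrix ℕ ^ i) u u) (k : ℕ) :
    spectralMoment k (attach H v R) ≤ spectralMoment k (attach H u R) := by
  rw [spectralMoment_eq_trace, spectralMoment_eq_trace, Nat.cast_le]
  let E : V → Matrix V (Fin 2) ℕ := fun z => Matrix.of fun a j =>
    if j = 0 then if a = z then 1 else 0 else if a ∈ R then 1 else 0
  let J : Matrix (Fin 2) (Fin 2) ℕ := !![0, 1; 1, 0]
  have hE : ∀ z, (∀ r ∈ R, ¬ H.Reachable z r) →
      (attach H z R).adjMatrix ℕ = H.adjMatrix ℕ + E z * J * (E z)ᵀ := by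
    intro z hz
    ext a c
    rw [adjMatrix_attach_apply hz, Matrix.add_apply, add_assoc]
    congr 1
    simp only [Matrix.mul_apply, Fin.sum_univ_two, Matrix.transpose_apply, E, J, Matrix.of_apply,
      one_ne_zero, if_true, if_false]
    split_ifs <;> simp
  rw [hE v hv, hE u hu]
  refine trace_pow_le (SimpleGraph.isSymm_adjMatrix _) _ _ ?_ ?_ k
  · ext i j
    fin_cases i <;> fin_cases j <;> rfl
  · have hzero : ∀ z, (∀ r ∈ R, ¬ H.Reachable z r) → ∀ i, ∀ r ∈ R,
        (H.adjMatrix ℕ ^ i) z r = 0 := by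
      intro z hz i r hr
      rw [SimpleGraph.adjMatrix_pow_apply_eq_card_walk, Nat.cast_id, Fintype.card_eq_zero_iff]
      exact ⟨fun p => hz r hr ⟨p.1⟩⟩
    have h00 : ∀ z (i : ℕ), ((E z)ᵀ * H.adjMatrix ℕ ^ i * E z) 0 0 = (H.adjMatrix ℕ ^ i) z z := by
      intro z i
      simp [Matrix.mul_apply, E]
    have h01 : ∀ z, (∀ r ∈ R, ¬ H.Reachable z r) → ∀ i : ℕ,
        ((E z)ᵀ * H.adjMatrix ℕ ^ i * E z) 0 1 = 0 := by
      intro z hz i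
      simp only [Matrix.mul_apply, E, Matrix.transpose_apply, Matrix.of_apply]
      simp only [if_true, one_ne_zero, if_false]
      refine Finset.sum_eq_zero fun r _ => ?_
      by_cases hr : r ∈ R
      · simp [hr, hzero z hz i r hr]
      · simp [hr]
    have h10 : ∀ z, (∀ r ∈ R, ¬ H.Reachable z r) → ∀ i : ℕ,
        ((E z)ᵀ * H.adjMatrix ℕ ^ i * E z) 1 0 = 0 := by
      intro z hz i
      have hs : ((E z)ᵀ * H.adjMatrix ℕ ^ i * E z)ᵀ = (E z)ᵀ * H.adjMatrix ℕ ^ i * E z := by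
        simp [Matrix.transpose_mul, Matrix.transpose_pow, Matrix.mul_assoc]
      exact (congrFun (congrFun hs 0) 1).trans (h01 z hz i)
    intro i a b
    fin_cases a <;> fin_cases b
    · exact (h00 v i).le.trans ((hle i).trans (h00 u i).ge)
    · exact (h01 v hv i).le.trans (Nat.zero_le _)
    · exact (h10 v hv i).le.trans (Nat.zero_le _)
    · simp [Matrix.mul_apply, E]

theorem isTree_iff_connected_and_sum_degrees {G : SimpleGraph V} :
    G.IsTree ↔ G.Connected ∧ ∑ v, G.degree v + 2 = 2 * Fintype.card V := by
  rw [SimpleGraph.isTree_iff_connected_and_card, G.sum_degrees_eq_twice_card_edges,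
    Nat.card_eq_fintype_card, Nat.card_eq_fintype_card, ← SimpleGraph.edgeFinset_card]
  constructor <;> rintro ⟨h1, h2⟩ <;> exact ⟨h1, by omega⟩

end Attach

/-! ### Moving branches along a path -/

section Shift

open scoped Classical

variable {V : Type*} [Fintype V]

/-- A path `x 0, …, x N` in the tree `T`, none of whose vertices before `x (b + m)` has a neighbour
outside of the path, except possibly `x b`. -/
structure IsShiftable (T : SimpleGraph V) (x : ℕ → V) (b m N : ℕ) : Prop where
  isTree : T.IsTree
  injOn : Set.InjOn x (Set.Iic N)
  adj : ∀ i < N, T.Adj (x i) (x (i + 1))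
  nbr : ∀ i < b + m, i ≠ b → ∀ w, T.Adj (x i) w → ∃ j ≤ N, w = x j ∧ (j = i + 1 ∨ i = j + 1)
  one_le_b : 1 ≤ b
  one_le_m : 1 ≤ m
  le_N : 2 * b + m ≤ N

/-- The neighbours of `x b` outside of the path `x`. -/
noncomputable def shiftSet (T : SimpleGraph V) (x : ℕ → V) (b : ℕ) : Finset V :=
  Finset.univ.filter fun w => T.Adj (x b) w ∧ w ≠ x (b - 1) ∧ w ≠ x (b + 1)

/-- The graph `T` without the edges from `x b` to its neighbours outside of the path `x`. -/
def shiftBase (T : SimpleGraph V) (x : ℕ → V) (b : ℕ) : SimpleGraph V where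
  Adj a c := T.Adj a c ∧ ¬ (a = x b ∧ c ∈ shiftSet T x b) ∧ ¬ (c = x b ∧ a ∈ shiftSet T x b)
  symm := ⟨fun _ _ h => ⟨h.1.symm, h.2.2, h.2.1⟩⟩
  loopless := ⟨fun a h => T.loopless.irrefl a h.1⟩

/-- The graph `T` with the branches at `x b` outside of the path `x` moved to `x (b + m)`. -/
noncomputable def shift (T : SimpleGraph V) (x : ℕ → V) (b m : ℕ) : SimpleGraph V :=
  attach (shiftBase T x b) (x (b + m)) (shiftSet T x b)

variable {T : SimpleGraph V} {x : ℕ → V} {b m N : ℕ}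

theorem mem_shiftSet {w : V} :
    w ∈ shiftSet T x b ↔ T.Adj (x b) w ∧ w ≠ x (b - 1) ∧ w ≠ x (b + 1) := by
  simp [shiftSet]

theorem attach_shiftBase : attach (shiftBase T x b) (x b) (shiftSet T x b) = T := by
  ext a c
  rw [attach_adj]
  constructor
  · rintro (h | ⟨rfl, h, -⟩ | ⟨rfl, h, -⟩)
    · exact h.1
    · exact (mem_shiftSet.1 h).1
    · exact (mem_shiftSet.1 h).1.symm
  · intro h
    by_cases h1 : a = x b ∧ c ∈ shiftSet T x b
    · exact Or.inr (Or.inl ⟨h1.1, h1.2, h1.1 ▸ h.ne'⟩)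
    by_cases h2 : c = x b ∧ a ∈ shiftSet T x b
    · exact Or.inr (Or.inr ⟨h2.1, h2.2, h2.1 ▸ h.ne⟩)
    exact Or.inl ⟨h, h1, h2⟩

namespace IsShiftable

variable (h : IsShiftable T x b m N)

include h

theorem ne_of_ne {i j : ℕ} (hi : i ≤ N) (hj : j ≤ N) (hij : i ≠ j) : x i ≠ x j :=
  fun he => hij (h.injOn hi hj he)

theorem adj_shiftBase {i : ℕ} (hi : i < N) : (shiftBase T x b).Adj (x i) (x (i + 1)) := by
  have := h.le_N
  have := h.one_le_b
  have := h.one_le_m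
  refine ⟨h.adj i hi, fun h1 => ?_, fun h1 => ?_⟩
  · have : i = b := h.injOn (by simp; omega) (by simp; omega) h1.1
    subst this
    exact (mem_shiftSet.1 h1.2).2.2 rfl
  · have : i + 1 = b := h.injOn (by simp; omega) (by simp; omega) h1.1
    subst this
    exact (mem_shiftSet.1 h1.2).2.1 rfl

theorem reachable_shiftBase : ∀ j, b + j ≤ N → (shiftBase T x b).Reachable (x b) (x (b + j)) := by
  intro j
  induction j with
  | zero => exact fun _ => SimpleGraph.Reachable.refl _
  | succ j ih => exact fun hj =>
      (ih (by omega)).trans (h.adj_shiftBase (i := b + j) (by omega)).reachable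

/-- Every edge of a tree is a bridge, and the edge from `x b` to `r` has been removed. -/
theorem not_reachable {r : V} (hr : r ∈ shiftSet T x b) :
    ¬ (shiftBase T x b).Reachable (x b) r := by
  have hb := SimpleGraph.isAcyclic_iff_forall_adj_isBridge.1 h.isTree.isAcyclic
    (mem_shiftSet.1 hr).1
  rw [SimpleGraph.isBridge_iff] at hb
  refine fun h1 => hb (h1.mono fun a c hac => ?_)
  rw [SimpleGraph.deleteEdges_adj]
  refine ⟨hac.1, fun h2 => ?_⟩
  simp only [Set.mem_singleton_iff, Sym2.eq_iff] at h2
  rcases h2 with ⟨rfl, rfl⟩ | ⟨rfl, rfl⟩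
  · exact hac.2.1 ⟨rfl, hr⟩
  · exact hac.2.2 ⟨rfl, hr⟩

theorem not_reachable' {r : V} (hr : r ∈ shiftSet T x b) :
    ¬ (shiftBase T x b).Reachable (x (b + m)) r := fun h1 =>
  h.not_reachable hr ((h.reachable_shiftBase m (by have := h.le_N; omega)).trans h1)

theorem ne : x b ≠ x (b + m) := by
  have := h.le_N
  have := h.one_le_m
  exact h.ne_of_ne (by omega) (by omega) (by omega)

/-- The reflection `x j ↦ x (2 * b + m - j)` sends `x b` to `x (b + m)` and the segment before `x (b
+ m)` into the path after `x b`; there is room for it because `2 * b + m ≤ N`. -/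
theorem pow_apply_self_le (i : ℕ) : ((shiftBase T x b).adjMatrix ℕ ^ i) (x b) (x b) ≤
    ((shiftBase T x b).adjMatrix ℕ ^ i) (x (b + m)) (x (b + m)) := by
  have hN := h.le_N
  have hb := h.one_le_b
  have hm := h.one_le_m
  refine GreedyTrees.pow_apply_self_le _ h.ne (fun i => ?_) i
  -- The index of a vertex on the segment; the default `0` is never evaluated.
  let ix : V → ℕ := fun w => if hw : ∃ j, j < b + m ∧ x j = w then hw.choose else 0
  have hix : ∀ j < b + m, ix (x j) = j := by
    intro j hj
    have hw : ∃ l, l < b + m ∧ x l = x j := ⟨j, hj, rfl⟩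
    have h1 := hw.choose_spec
    simp only [ix, hw, dif_pos]
    exact h.injOn (by simp; omega) (by simp; omega) h1.2
  let φ : V → V := fun w => x (2 * b + m - ix w)
  have hφ : ∀ j < b + m, φ (x j) = x (2 * b + m - j) := by
    intro j hj
    simp only [φ, hix j hj]
  have hS : ∀ w, w ∈ (Finset.range (b + m)).image x ↔ ∃ j < b + m, x j = w := by simp
  have key := pow_apply_le_of_injOn (deleteVertex ((shiftBase T x b).adjMatrix ℕ) (x (b + m)))
    (deleteVertex ((shiftBase T x b).adjMatrix ℕ) (x b)) ((Finset.range (b + m)).image x) φ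
    ?_ ?_ ?_ i (x b) ((hS _).2 ⟨b, by omega, rfl⟩) (x b) ((hS _).2 ⟨b, by omega, rfl⟩)
  · rwa [hφ b (by omega), show 2 * b + m - b = b + m by omega] at key
  -- With `x (b + m)` deleted no edge leaves the segment: at `x b` the branches are detached,
  -- elsewhere all neighbours lie on the path.
  · intro w hw y hy
    obtain ⟨j, hj, rfl⟩ := (hS w).1 hw
    rw [hS]
    simp only [deleteVertex, Matrix.of_apply, SimpleGraph.adjMatrix_apply, ne_eq,
      ite_eq_left_iff, not_forall, ite_eq_right_iff, one_ne_zero, not_or] at hy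
    obtain ⟨⟨-, hy1⟩, hy2, -⟩ := hy
    by_cases hjb : j = b
    · subst hjb
      have h1 : y = x (j - 1) ∨ y = x (j + 1) := by
        by_contra hcon
        push Not at hcon
        exact hy2.2.1 ⟨rfl, mem_shiftSet.2 ⟨hy2.1, hcon.1, hcon.2⟩⟩
      rcases h1 with rfl | rfl
      · exact ⟨j - 1, by omega, rfl⟩
      · refine ⟨j + 1, ?_, rfl⟩
        by_contra hcon
        exact hy1 (by rw [show j + 1 = j + m by omega])
    · obtain ⟨l, hl, rfl, h2⟩ := h.nbr j hj hjb y hy2.1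
      refine ⟨l, ?_, rfl⟩
      by_contra hcon
      exact hy1 (by rw [show l = b + m by omega])
  · intro w hw y hy hwy
    obtain ⟨j, hj, rfl⟩ := (hS w).1 hw
    obtain ⟨l, hl, rfl⟩ := (hS y).1 hy
    rw [hφ j hj, hφ l hl] at hwy
    have := h.injOn (by simp; omega) (by simp; omega) hwy
    rw [show j = l by omega]
  · intro w hw y hy
    obtain ⟨j, hj, rfl⟩ := (hS w).1 hw
    obtain ⟨l, hl, rfl⟩ := (hS y).1 hy
    rw [hφ j hj, hφ l hl]
    have hne : ∀ j < b + m, x (2 * b + m - j) ≠ x b := fun j hj =>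
      h.ne_of_ne (by omega) (by omega) (by omega)
    simp only [deleteVertex, Matrix.of_apply, SimpleGraph.adjMatrix_apply, hne j hj, hne l hl,
      or_self, if_false]
    by_cases h2 : (shiftBase T x b).Adj (x j) (x l)
    swap
    · simp [h2]
    suffices h3 : (shiftBase T x b).Adj (x (2 * b + m - j)) (x (2 * b + m - l)) by
      rw [if_pos h3]
      split_ifs <;> simp
    have h4 : l = j + 1 ∨ j = l + 1 := by
      by_cases hjb : j = b
      · subst hjb
        by_contra hcon
        refine h2.2.1 ⟨rfl, mem_shiftSet.2 ⟨h2.1, ?_, ?_⟩⟩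
        · exact h.ne_of_ne (by omega) (by omega) (by omega)
        · exact h.ne_of_ne (by omega) (by omega) (by omega)
      · obtain ⟨l', hl', h5, h6⟩ := h.nbr j hj hjb _ h2.1
        have := h.injOn (by simp; omega) (by simp; omega) h5
        omega
    rcases h4 with rfl | rfl
    · have := h.adj_shiftBase (i := 2 * b + m - (j + 1)) (by omega)
      rw [show 2 * b + m - (j + 1) + 1 = 2 * b + m - j by omega] at this
      exact this.symm
    · have := h.adj_shiftBase (i := 2 * b + m - (l + 1)) (by omega)
      rwa [show 2 * b + m - (l + 1) + 1 = 2 * b + m - l by omega] at this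

theorem spectralMoment_le (k : ℕ) : spectralMoment k T ≤ spectralMoment k (shift T x b m) := by
  have := spectralMoment_attach_le (fun r hr => h.not_reachable hr)
    (fun r hr => h.not_reachable' hr) h.pow_apply_self_le k
  rwa [attach_shiftBase] at this

theorem card_shiftSet : (shiftSet T x b).card + 2 = T.degree (x b) := by
  have hN := h.le_N
  have hb := h.one_le_b
  have h1 : T.neighborFinset (x b) = shiftSet T x b ∪ {x (b - 1), x (b + 1)} := by
    ext w
    simp only [SimpleGraph.mem_neighborFinset, Finset.mem_union, mem_shiftSet, Finset.mem_insert,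
      Finset.mem_singleton]
    constructor
    · intro hw
      by_cases h2 : w = x (b - 1) <;> by_cases h3 : w = x (b + 1) <;> simp [hw, h2, h3]
    · rintro (hw | rfl | rfl)
      · exact hw.1
      · have := h.adj (b - 1) (by omega)
        rw [show b - 1 + 1 = b by omega] at this
        exact this.symm
      · exact h.adj b (by have := h.one_le_m; omega)
  rw [← SimpleGraph.card_neighborFinset_eq_degree, h1, Finset.card_union_of_disjoint,
    Finset.card_pair (h.ne_of_ne (by omega) (by omega) (by omega))]
  rw [Finset.disjoint_left]
  intro w hw hw2
  have := mem_shiftSet.1 hw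
  simp only [Finset.mem_insert, Finset.mem_singleton] at hw2
  tauto

/-- `T` and its shift arise from one base graph by attaching the same set at two vertices; both
corrections are added so as to avoid subtraction. -/
theorem degree_shift (w : V) : (shift T x b m).degree w +
    (if w = x b then (shiftSet T x b).card else 0) =
    T.degree w + if w = x (b + m) then (shiftSet T x b).card else 0 := by
  have h1 := degree_attach (fun r hr => h.not_reachable hr) w
  have h2 := degree_attach (fun r hr => h.not_reachable' hr) w
  rw [attach_shiftBase] at h1
  rw [shift, h1, h2]
  omega

theorem degree_shift_start : (shift T x b m).degree (x b) = 2 := by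
  have h1 := h.degree_shift (x b)
  have h2 := h.card_shiftSet
  rw [if_pos rfl, if_neg h.ne] at h1
  omega

theorem degree_shift_end :
    (shift T x b m).degree (x (b + m)) + 2 = T.degree (x (b + m)) + T.degree (x b) := by
  have h1 := h.degree_shift (x (b + m))
  have h2 := h.card_shiftSet
  rw [if_pos rfl, if_neg h.ne.symm] at h1
  omega

theorem degree_shift_of_ne {w : V} (h1 : w ≠ x b) (h2 : w ≠ x (b + m)) :
    (shift T x b m).degree w = T.degree w := by
  simpa [h1, h2] using h.degree_shift w

theorem two_le_degree {i : ℕ} (h1 : 1 ≤ i) (h2 : i < N) : 2 ≤ T.degree (x i) := by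
  have h3 := h.adj (i - 1) (by omega)
  rw [show i - 1 + 1 = i by omega] at h3
  rw [← SimpleGraph.card_neighborFinset_eq_degree,
    ← Finset.card_pair (h.ne_of_ne (i := i - 1) (j := i + 1) (by omega) (by omega) (by omega))]
  refine Finset.card_le_card fun w hw => ?_
  simp only [Finset.mem_insert, Finset.mem_singleton] at hw
  rw [SimpleGraph.mem_neighborFinset]
  rcases hw with rfl | rfl
  · exact h3.symm
  · exact h.adj i h2

theorem numLeaves_shift : numLeaves (shift T x b m) = numLeaves T := by
  have hN := h.le_N
  have hb := h.one_le_b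
  have hm := h.one_le_m
  unfold numLeaves
  congr 1
  ext w
  simp only [Finset.mem_filter, Finset.mem_univ, true_and]
  have hbd := h.two_le_degree (i := b) (by omega) (by omega)
  have hbm := h.two_le_degree (i := b + m) (by omega) (by omega)
  by_cases h1 : w = x b
  · subst h1
    rw [h.degree_shift_start]
    omega
  by_cases h2 : w = x (b + m)
  · subst h2
    have := h.degree_shift_end
    omega
  · rw [h.degree_shift_of_ne h1 h2]

/-- The degree sum is unchanged, so connectedness is all that matters. -/
theorem isTree_shift : (shift T x b m).IsTree := by
  have hN := h.le_N
  rw [isTree_iff_connected_and_sum_degrees]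
  constructor
  · have hvu : (shift T x b m).Reachable (x b) (x (b + m)) :=
      (h.reachable_shiftBase m (by omega)).mono fun _ _ hac => Or.inl hac
    have hr : ∀ r ∈ shiftSet T x b, (shift T x b m).Reachable (x b) r := by
      intro r hr
      refine hvu.trans (SimpleGraph.Adj.reachable (Or.inr (Or.inl ⟨rfl, hr, ?_⟩)))
      rintro rfl
      exact h.not_reachable' hr (SimpleGraph.Reachable.refl _)
    have hadj : ∀ a c, T.Adj a c → (shift T x b m).Reachable a c := by
      intro a c hac
      by_cases h1 : a = x b ∧ c ∈ shiftSet T x b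
      · rw [h1.1]
        exact hr c h1.2
      by_cases h2 : c = x b ∧ a ∈ shiftSet T x b
      · rw [h2.1]
        exact (hr a h2.2).symm
      exact SimpleGraph.Adj.reachable (Or.inl ⟨hac, h1, h2⟩)
    have := h.isTree.connected.nonempty
    refine SimpleGraph.Connected.mk fun a c => ?_
    obtain ⟨p⟩ := h.isTree.connected a c
    induction p with
    | nil => exact SimpleGraph.Reachable.refl _
    | cons hac _ ih => exact (hadj _ _ hac).trans ih
  · rw [← (isTree_iff_connected_and_sum_degrees.1 h.isTree).2]
    have := Finset.sum_congr rfl fun w (_ : w ∈ Finset.univ) => h.degree_shift w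
    rw [Finset.sum_add_distrib, Finset.sum_add_distrib] at this
    simp only [Finset.sum_ite_eq', Finset.mem_univ, if_true] at this
    omega

end IsShiftable

end Shift

/-! ### Parents, children and distances in a rooted tree -/

section TreeDistance

open scoped Classical

variable {V : Type*} [Fintype V] {T : SimpleGraph V}

theorem exists_adj_dist_add_one (hT : T.IsTree) {r w : V} (h : w ≠ r) :
    ∃ p, T.Adj w p ∧ T.dist r p + 1 = T.dist r w := by
  obtain ⟨q, hq⟩ := hT.connected.exists_walk_length_eq_dist w r
  cases q with
  | nil => exact absurd rfl h
  | @cons _ p _ hp q =>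
    refine ⟨p, hp, ?_⟩
    have h1 : T.dist r p ≤ q.length := by
      rw [SimpleGraph.dist_comm]
      exact SimpleGraph.dist_le q
    rw [SimpleGraph.Walk.length_cons, SimpleGraph.dist_comm] at hq
    rcases hT.dist_eq_dist_add_one_of_adj r hp with h2 | h2 <;> omega

/-- Geodesics from `r` to `p` and to `p'` both extend to paths from `r` to `w`, and this path is
unique. -/
theorem eq_of_adj_of_dist_lt (hT : T.IsTree) {r w p p' : V} (hp : T.Adj w p) (hp' : T.Adj w p')
    (h : T.dist r p < T.dist r w) (h' : T.dist r p' < T.dist r w) : p = p' := by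
  have key : ∀ p, T.Adj w p → T.dist r p < T.dist r w →
      ∃ q : T.Walk r w, q.IsPath ∧ q.penultimate = p := by
    intro p hp h
    obtain ⟨q, hq⟩ := hT.connected.exists_walk_length_eq_dist r p
    refine ⟨q.concat hp.symm, ?_, by simp⟩
    apply SimpleGraph.Walk.isPath_of_length_eq_dist
    rw [SimpleGraph.Walk.length_concat]
    rcases hT.dist_eq_dist_add_one_of_adj r hp with h2 | h2 <;> omega
  obtain ⟨q, hq, rfl⟩ := key p hp h
  obtain ⟨q', hq', rfl⟩ := key p' hp' h'
  rw [(hT.existsUnique_path r w).unique hq hq']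

theorem exists_child (hT : T.IsTree) (r : V) {w : V} (h : 2 ≤ T.degree w) :
    ∃ c, T.Adj w c ∧ T.dist r c = T.dist r w + 1 := by
  rw [← SimpleGraph.card_neighborFinset_eq_degree] at h
  obtain ⟨a, ha, c, hc, hac⟩ := Finset.one_lt_card.1 h
  rw [SimpleGraph.mem_neighborFinset] at ha hc
  rcases hT.dist_eq_dist_add_one_of_adj r ha with h1 | h1
  · rcases hT.dist_eq_dist_add_one_of_adj r hc with h2 | h2
    · exact absurd (eq_of_adj_of_dist_lt hT (r := r) ha hc (by omega) (by omega)) hac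
    · exact ⟨c, hc, h2⟩
  · exact ⟨a, ha, h1⟩

theorem one_le_degree (hT : T.IsTree) {r w : V} (h : w ≠ r) : 1 ≤ T.degree w := by
  obtain ⟨p, hp, -⟩ := exists_adj_dist_add_one hT h
  exact (SimpleGraph.degree_pos_iff_exists_adj T w).2 ⟨p, hp⟩

theorem two_le_degree_of_adj {w a c : V} (ha : T.Adj w a) (hc : T.Adj w c) (hac : a ≠ c) :
    2 ≤ T.degree w := by
  rw [← SimpleGraph.card_neighborFinset_eq_degree, ← Finset.card_pair hac]
  refine Finset.card_le_card fun y hy => ?_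
  simp only [Finset.mem_insert, Finset.mem_singleton] at hy
  rw [SimpleGraph.mem_neighborFinset]
  rcases hy with rfl | rfl <;> assumption

theorem eq_or_eq_of_degree_le_two {w a c y : V} (h : T.degree w ≤ 2) (ha : T.Adj w a)
    (hc : T.Adj w c) (hac : a ≠ c) (hy : T.Adj w y) : y = a ∨ y = c := by
  by_contra hcon
  push Not at hcon
  have : ({y, a, c} : Finset V).card ≤ T.degree w := by
    rw [← SimpleGraph.card_neighborFinset_eq_degree]
    refine Finset.card_le_card fun z hz => ?_
    simp only [Finset.mem_insert, Finset.mem_singleton] at hz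
    rw [SimpleGraph.mem_neighborFinset]
    rcases hz with rfl | rfl | rfl <;> assumption
  rw [Finset.card_eq_three.2 ⟨y, a, c, hcon.1, hcon.2, hac, rfl⟩] at this
  omega

theorem eq_of_degree_le_one {w a y : V} (h : T.degree w ≤ 1) (ha : T.Adj w a)
    (hy : T.Adj w y) : y = a := by
  by_contra hcon
  have := two_le_degree_of_adj hy ha hcon
  omega

theorem dist_le_of_descent (hT : T.Connected) {r : V} (f : V → ℕ)
    (h : ∀ w, w ≠ r → ∃ p, T.Adj w p ∧ f p < f w) (w : V) : T.dist r w ≤ f w := by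
  induction hf : f w using Nat.strong_induction_on generalizing w with
  | _ k ih =>
    by_cases hw : w = r
    · simp [hw]
    · obtain ⟨p, hp, hlt⟩ := h w hw
      have h1 := ih (f p) (hf ▸ hlt) p rfl
      have h2 := hT.dist_triangle (u := r) (v := p) (w := w)
      rw [SimpleGraph.dist_eq_one_iff_adj.2 hp.symm] at h2
      omega

end TreeDistance

/-! ### Leaf-to-leaf paths through two branching vertices -/

section PathSequences

open scoped Classical

variable {V : Type*} [Fintype V] {T : SimpleGraph V}

/-- The vertices `x 0, …, x N` form a path in `T`. -/
structure IsPathSeq (T : SimpleGraph V) (x : ℕ → V) (N : ℕ) : Prop where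
  injOn : Set.InjOn x (Set.Iic N)
  adj : ∀ i < N, T.Adj (x i) (x (i + 1))

theorem isPathSeq_getVert {a c : V} (p : T.Walk a c) (hp : p.IsPath) :
    IsPathSeq T p.getVert p.length :=
  ⟨hp.getVert_injOn, fun _ hi => p.adj_getVert_succ hi⟩

namespace IsPathSeq

variable {x : ℕ → V} {N : ℕ} (h : IsPathSeq T x N)

include h

theorem ne_of_ne {i j : ℕ} (hi : i ≤ N) (hj : j ≤ N) (hij : i ≠ j) : x i ≠ x j :=
  fun he => hij (h.injOn hi hj he)

theorem adj_sub_one {i : ℕ} (h1 : 1 ≤ i) (hi : i ≤ N) : T.Adj (x i) (x (i - 1)) := by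
  have := h.adj (i - 1) (by omega)
  rw [show i - 1 + 1 = i by omega] at this
  exact this.symm

theorem reverse : IsPathSeq T (fun i => x (N - i)) N where
  injOn i hi j hj hij := by
    have := h.injOn (by simp) (by simp) hij
    simp only [Set.mem_Iic] at hi hj
    omega
  adj i hi := by
    have := h.adj_sub_one (i := N - i) (by omega) (by omega)
    rwa [show N - i - 1 = N - (i + 1) by omega] at this

theorem dist_le (hT : T.Connected) {i j : ℕ} (hij : i ≤ j) (hj : j ≤ N) :
    T.dist (x i) (x j) ≤ j - i := by
  induction j, hij using Nat.le_induction with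
  | base => simp
  | succ j hij ih =>
    have h1 := ih (by omega)
    have h2 := hT.dist_triangle (u := x i) (v := x j) (w := x (j + 1))
    rw [SimpleGraph.dist_eq_one_iff_adj.2 (h.adj j (by omega))] at h2
    omega

theorem nbr {i : ℕ} (hi : i < N) (hd : T.degree (x i) ≤ 2) (h0 : T.degree (x 0) = 1) {w : V}
    (hw : T.Adj (x i) w) : ∃ j ≤ N, w = x j ∧ (j = i + 1 ∨ i = j + 1) := by
  rcases Nat.eq_zero_or_pos i with rfl | hpos
  · exact ⟨1, hi, eq_of_degree_le_one h0.le (h.adj 0 hi) hw, Or.inl rfl⟩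
  · rcases eq_or_eq_of_degree_le_two hd (h.adj_sub_one hpos hi.le) (h.adj i hi)
      (h.ne_of_ne (by omega) (by omega) (by omega)) hw with h1 | h1
    · exact ⟨i - 1, by omega, h1, by omega⟩
    · exact ⟨i + 1, by omega, h1, by omega⟩

/-- Taking `m` minimal makes the vertices between `x b` and `x (b + m)` non-branching; `hgt` keeps
`x (b + m)` at least `b` steps from the far end, which is `2 * b + m ≤ N`. -/
theorem exists_isShiftable_of_first (hT : T.IsTree) (h0 : T.degree (x 0) = 1) {b : ℕ} (hbN : b ≤ N)
    (hb : 3 ≤ T.degree (x b)) (hlt : ∀ i < b, T.degree (x i) ≤ 2)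
    (hgt : ∀ i < b, T.degree (x (N - i)) ≤ 2) (hex : ∃ j ≤ N, j ≠ b ∧ 3 ≤ T.degree (x j)) :
    ∃ m, IsShiftable T x b m N ∧ 3 ≤ T.degree (x (b + m)) := by
  have hex' : ∃ m, 1 ≤ m ∧ b + m ≤ N ∧ 3 ≤ T.degree (x (b + m)) := by
    obtain ⟨j, hj, hjb, hd⟩ := hex
    have : b < j := by
      by_contra hcon
      have := hlt j (by omega)
      omega
    exact ⟨j - b, by omega, by omega, by rwa [show b + (j - b) = j by omega]⟩
  obtain ⟨h1, h2, h3⟩ := Nat.find_spec hex'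
  have hmin := fun i => Nat.find_min hex' (m := i)
  set m := Nat.find hex'
  have hb0 : b ≠ 0 := by
    rintro rfl
    omega
  refine ⟨m, ⟨hT, h.injOn, h.adj, fun i hi hib w hw => ?_, by omega, h1, ?_⟩, h3⟩
  · refine h.nbr (by omega) ?_ h0 hw
    by_contra hcon
    rcases lt_or_gt_of_ne hib with h4 | h4
    · exact hcon (hlt i h4)
    · refine hmin (i - b) (by omega) ⟨by omega, by omega, ?_⟩
      rw [show b + (i - b) = i by omega]
      omega
  · by_contra hcon
    have := hgt (N - (b + m)) (by omega)
    rw [show N - (N - (b + m)) = b + m by omega] at this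
    omega

/-- Here `b` is the least number of steps from either end to a branching vertex; the path is
reversed if the far end attains it. -/
theorem exists_isShiftable (hT : T.IsTree) (h0 : T.degree (x 0) = 1) (hN : T.degree (x N) = 1)
    {i j : ℕ} (hi : i ≤ N) (hj : j ≤ N) (hij : i ≠ j) (hdi : 3 ≤ T.degree (x i))
    (hdj : 3 ≤ T.degree (x j)) : ∃ (y : ℕ → V) (b m : ℕ), IsShiftable T y b m N ∧
      3 ≤ T.degree (y b) ∧ 3 ≤ T.degree (y (b + m)) := by
  have hex : ∃ b, 3 ≤ T.degree (x b) ∨ 3 ≤ T.degree (x (N - b)) := ⟨i, Or.inl hdi⟩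
  have hb := Nat.find_spec hex
  have hmin := fun i => Nat.find_min hex (m := i)
  have hbi : Nat.find hex ≤ i := Nat.find_le (Or.inl hdi)
  set b := Nat.find hex
  have hlt1 : ∀ i < b, T.degree (x i) ≤ 2 := fun i hi => by
    have := hmin i hi
    omega
  have hlt2 : ∀ i < b, T.degree (x (N - i)) ≤ 2 := fun i hi => by
    have := hmin i hi
    omega
  rcases hb with hb | hb
  · obtain ⟨m, h1, h2⟩ := h.exists_isShiftable_of_first hT h0 (by omega) hb hlt1 hlt2 (by
      by_cases hib : i = b
      · exact ⟨j, hj, by omega, hdj⟩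
      · exact ⟨i, hi, hib, hdi⟩)
    exact ⟨x, b, m, h1, hb, h2⟩
  · obtain ⟨m, h1, h2⟩ := h.reverse.exists_isShiftable_of_first hT (by simpa using hN)
      (b := b) (by omega) hb hlt2 (fun i hi => by
        rw [show N - (N - i) = i by omega]
        exact hlt1 i hi) (by
      by_cases hib : N - i = b
      · exact ⟨N - j, by omega, by omega, by rwa [show N - (N - j) = j by omega]⟩
      · exact ⟨N - i, by omega, hib, by rwa [show N - (N - i) = i by omega]⟩)
    exact ⟨_, b, m, h1, hb, h2⟩

end IsPathSeq

/-- In a tree, there is a path between two leaves through any two given vertices. -/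
theorem exists_isPathSeq_through (hT : T.IsTree) {v u : V} (hvu : v ≠ u) :
    ∃ (x : ℕ → V) (N i j : ℕ), IsPathSeq T x N ∧ T.degree (x 0) = 1 ∧ T.degree (x N) = 1 ∧
      i ≤ N ∧ j ≤ N ∧ x i = v ∧ x j = u := by
  have hc := hT.connected
  -- A longest geodesic through `v` and then `u`: an end that is not a leaf would have a neighbour
  -- prolonging it.
  obtain ⟨⟨a, c⟩, hmem, hmax⟩ := Finset.exists_max_image
    (Finset.univ.filter fun q : V × V => T.dist q.1 q.2 =
      T.dist q.1 v + T.dist v u + T.dist u q.2) (fun q => T.dist q.1 q.2) ⟨(v, u), by simp⟩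
  simp only [Finset.mem_filter, Finset.mem_univ, true_and, Prod.forall] at hmem hmax
  have hpos := hc.pos_dist_of_ne hvu
  have hac : a ≠ c := by
    rintro rfl
    simp at hmem
    omega
  have ha : T.degree a = 1 := by
    by_contra hcon
    have h1 := one_le_degree hT hac
    obtain ⟨a', ha', h2⟩ := exists_child hT c (w := a) (by omega)
    rw [SimpleGraph.dist_comm, SimpleGraph.dist_comm (v := a)] at h2
    have h3 := hc.dist_triangle (u := a') (v := v) (w := c)
    have h4 := hc.dist_triangle (u := v) (v := u) (w := c)
    have h5 := hc.dist_triangle (u := a') (v := a) (w := v)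
    rw [SimpleGraph.dist_eq_one_iff_adj.2 ha'.symm] at h5
    have := hmax a' c (by omega)
    omega
  have hc' : T.degree c = 1 := by
    by_contra hcon
    have h1 := one_le_degree hT hac.symm
    obtain ⟨c', hc', h2⟩ := exists_child hT a (w := c) (by omega)
    have h3 := hc.dist_triangle (u := a) (v := u) (w := c')
    have h4 := hc.dist_triangle (u := a) (v := v) (w := u)
    have h5 := hc.dist_triangle (u := u) (v := c) (w := c')
    rw [SimpleGraph.dist_eq_one_iff_adj.2 hc'] at h5
    have := hmax a c' (by omega)
    omega
  obtain ⟨p, hp⟩ := hc.exists_walk_length_eq_dist a v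
  obtain ⟨q, hq⟩ := hc.exists_walk_length_eq_dist v u
  obtain ⟨s, hs⟩ := hc.exists_walk_length_eq_dist u c
  have hlen : (p.append (q.append s)).length = T.dist a c := by
    simp only [SimpleGraph.Walk.length_append]
    omega
  refine ⟨_, _, p.length, p.length + q.length,
    isPathSeq_getVert _ ((p.append (q.append s)).isPath_of_length_eq_dist hlen), ?_, ?_, ?_, ?_, ?_, ?_⟩
  · rw [SimpleGraph.Walk.getVert_zero]
    exact ha
  · rw [SimpleGraph.Walk.getVert_length]
    exact hc'
  · simp
  · simp only [SimpleGraph.Walk.length_append]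
    omega
  · simp [SimpleGraph.Walk.getVert_append]
  · simp [SimpleGraph.Walk.getVert_append]

end PathSequences

/-! ### Reduction to a single branching vertex -/

section Spiders

open scoped Classical

variable {V : Type*} [Fintype V]

/-- Every tree can be transformed to one with at most one branching vertex without changing the
number of leaves and without decreasing any spectral moment. -/
theorem exists_subsingleton_branching (T : SimpleGraph V) (hT : T.IsTree) :
    ∃ T' : SimpleGraph V, T'.IsTree ∧ numLeaves T' = numLeaves T ∧
      (∀ k, spectralMoment k T ≤ spectralMoment k T') ∧
      ∀ v u, 3 ≤ T'.degree v → 3 ≤ T'.degree u → v = u := by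
  induction hn : (Finset.univ.filter fun v => 3 ≤ T.degree v).card using Nat.strong_induction_on
    generalizing T with
  | _ n ih =>
    by_cases hex : ∀ v u, 3 ≤ T.degree v → 3 ≤ T.degree u → v = u
    · exact ⟨T, hT, rfl, fun _ => le_rfl, hex⟩
    · push Not at hex
      obtain ⟨v, u, hv, hu, hvu⟩ := hex
      obtain ⟨x, N, i, j, hx, h0, hN, hi, hj, rfl, rfl⟩ := exists_isPathSeq_through hT hvu
      obtain ⟨y, b, m, hy, hb, hbm⟩ := hx.exists_isShiftable hT h0 hN hi hj
        (fun h => hvu (h ▸ rfl)) hv hu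
      -- The number of branching vertices drops: `y b` gets degree two, and `y (b + m)` was already
      -- branching.
      obtain ⟨T', h1, h2, h3, h4⟩ := ih _ (hn ▸ Finset.card_lt_card (by
        rw [Finset.ssubset_iff_of_subset]
        · refine ⟨y b, by simpa using hb, ?_⟩
          simp [hy.degree_shift_start]
        · intro w hw
          simp only [Finset.mem_filter, Finset.mem_univ, true_and] at hw ⊢
          by_cases hwb : w = y b
          · rwa [hwb]
          by_cases hwm : w = y (b + m)
          · rwa [hwm]
          rwa [hy.degree_shift_of_ne hwb hwm] at hw)) _ hy.isTree_shift rfl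
      exact ⟨T', h1, h2.trans hy.numLeaves_shift,
        fun k => (hy.spectralMoment_le k).trans (h3 k), h4⟩

/-- `T` is a tree in which all the vertices except possibly `r` have degree at most two. -/
structure IsSpider (T : SimpleGraph V) (r : V) : Prop where
  isTree : T.IsTree
  degree_le_two : ∀ w, w ≠ r → T.degree w ≤ 2

theorem exists_isSpider {T : SimpleGraph V} (hT : T.IsTree) (hV : 3 ≤ Fintype.card V)
    (h : ∀ v u, 3 ≤ T.degree v → 3 ≤ T.degree u → v = u) :
    ∃ r, IsSpider T r ∧ 2 ≤ T.degree r := by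
  by_cases hex : ∃ r, 3 ≤ T.degree r
  · obtain ⟨r, hr⟩ := hex
    refine ⟨r, ⟨hT, fun w hw => ?_⟩, by omega⟩
    by_contra hcon
    exact hw (h w r (by omega) hr)
  · push Not at hex
    by_contra hcon
    push Not at hcon
    -- If all degrees were at most one, their sum `2n - 2` would not exceed `n`, against `3 ≤ n`.
    have h1 := (isTree_iff_connected_and_sum_degrees.1 hT).2
    have h2 : ∑ v, T.degree v ≤ ∑ _v : V, 1 := Finset.sum_le_sum fun v _ => by
      have := hcon v ⟨hT, fun w _ => by
        have := hex w
        omega⟩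
      omega
    simp at h2
    omega

end Spiders

/-! ### Balancing the legs of a spider -/

section Balancing

open scoped Classical

variable {V : Type*} [Fintype V]

/-- The spider `T` with centre `r` is balanced: the degrees do not increase with the distance from
`r`. -/
structure IsBalancedSpider (T : SimpleGraph V) (r : V) : Prop extends IsSpider T r where
  degree_le : ∀ u v : V, T.dist r v = T.dist r u + 1 → T.degree v ≤ T.degree u

/-- With truncated subtraction the two terms add up to `|i - h|`. Moving the origin to `h + 1` costs
one for each `i ≤ h` and gains one for each larger `i`. -/
theorem sum_dist_shift (h N : ℕ) :
    ∑ i ∈ Finset.range N, ((i - (h + 1)) + (h + 1 - i)) + (N - (h + 1)) =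
      ∑ i ∈ Finset.range N, ((i - h) + (h - i)) + min N (h + 1) := by
  induction N with
  | zero => simp
  | succ N ih =>
    rw [Finset.sum_range_succ, Finset.sum_range_succ]
    omega

/-- In a spider, a path from a leaf at distance `h` from the centre to a vertex farther away from the
centre passes through the centre after `h` steps. -/
theorem IsSpider.dist_of_isPathSeq {T : SimpleGraph V} {r : V} (hT : IsSpider T r) {x : ℕ → V}
    {N : ℕ} (hx : IsPathSeq T x N) (h0 : T.degree (x 0) = 1)
    (hN : T.dist r (x 0) < T.dist r (x N)) :
    ∀ i ≤ T.dist r (x 0), i ≤ N ∧ T.dist r (x i) = T.dist r (x 0) - i := by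
  intro i
  induction i using Nat.strong_induction_on with
  | _ i ih =>
  intro hi
  cases i with
  | zero => simp
  | succ i =>
    obtain ⟨hiN, hd⟩ := ih i (by omega) (by omega)
    have hlt : i < N := by
      refine lt_of_le_of_ne hiN ?_
      rintro rfl
      omega
    refine ⟨hlt, ?_⟩
    have hne : x i ≠ r := by
      intro he
      rw [he, SimpleGraph.dist_self] at hd
      omega
    obtain ⟨p, hp, hpd⟩ := exists_adj_dist_add_one hT.isTree hne
    obtain ⟨j, hj, rfl, rfl | rfl⟩ := hx.nbr hlt (hT.degree_le_two _ hne) h0 hp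
    · omega
    · have := (ih j (by omega) (by omega)).2
      omega

/-- Imbalance means that a leg ends at some distance `h` while a vertex at distance `h + 1` has a
child, so the longest leg has length at least `h + 2`. Moving the centre one step into it lengthens
the short leg and shortens the long one. -/
theorem IsSpider.exists_balance {T : SimpleGraph V} {r : V} (hT : IsSpider T r)
    (hr : 2 ≤ T.degree r) (hnot : ¬ IsBalancedSpider T r) :
    ∃ (T' : SimpleGraph V) (r' : V), IsSpider T' r' ∧ 2 ≤ T'.degree r' ∧
      numLeaves T' = numLeaves T ∧ (∀ k, spectralMoment k T ≤ spectralMoment k T') ∧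
      ∑ w, T'.dist r' w < ∑ w, T.dist r w := by
  have hc := hT.isTree.connected
  have hex : ∃ u v : V, T.dist r v = T.dist r u + 1 ∧ T.degree u < T.degree v := by
    by_contra hcon
    push Not at hcon
    exact hnot ⟨hT, hcon⟩
  obtain ⟨u, v, huv, hdeg⟩ := hex
  have hvr : v ≠ r := by
    rintro rfl
    simp at huv
  have hv2 := hT.degree_le_two v hvr
  have hur : u ≠ r := by
    rintro rfl
    omega
  have hu1 : T.degree u = 1 := by
    have := one_le_degree hT.isTree hur
    omega
  obtain ⟨c, -, hcd⟩ := exists_child hT.isTree r (w := v) (by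
    have := one_le_degree hT.isTree hur
    omega)
  obtain ⟨y, -, hy⟩ := Finset.exists_max_image Finset.univ (fun w => T.dist r w) ⟨r, by simp⟩
  have hyc := hy c (Finset.mem_univ c)
  obtain ⟨p, hp, hpl⟩ := hc.exists_path_of_dist u y
  have hx := isPathSeq_getVert p hp
  have hx0 := p.getVert_zero
  have hxN := p.getVert_length
  generalize p.length = N at *
  generalize p.getVert = x at *
  have hb := hc.pos_dist_of_ne hur.symm
  have h0 : T.degree (x 0) = 1 := by
    rw [hx0]
    exact hu1
  have hdesc := hT.dist_of_isPathSeq hx h0 (by rw [hx0, hxN]; omega)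
  rw [hx0] at hdesc
  generalize hh : T.dist r u = h at *
  have hxh : x h = r := by
    have := (hdesc h le_rfl).2
    rw [Nat.sub_self] at this
    exact (hc.dist_eq_zero_iff.1 this).symm
  have hhN := (hdesc h le_rfl).1
  have hasc : ∀ i, h ≤ i → i ≤ N → T.dist r (x i) = i - h := by
    intro i hi hiN
    have h1 := hx.dist_le hc hi hiN
    rw [hxh] at h1
    have h2 := hx.dist_le hc hhN le_rfl
    rw [hxh, hxN] at h2
    have h4 := hx.dist_le hc hiN le_rfl
    have h5 := hc.dist_triangle (u := r) (v := x i) (w := x N)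
    rw [hxN] at h4 h5
    have h6 : T.dist u r = h := by rw [SimpleGraph.dist_comm, hh]
    have h7 := hc.dist_triangle (u := u) (v := r) (w := y)
    omega
  have hdist : ∀ i ≤ N, T.dist r (x i) = (i - h) + (h - i) := by
    intro i hi
    rcases le_total i h with h1 | h1
    · rw [(hdesc i h1).2]
      omega
    · rw [hasc i h1 hi]
      omega
  have hNy : T.dist r y = N - h := by rw [← hxN, hasc N hhN le_rfl]
  -- The path from `u` to the farthest vertex `y` meets the centre at step `h`, and `N - h ≥ h + 2`
  -- leaves room for the reflection.
  have hS : IsShiftable T x h 1 N := by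
    refine ⟨hT.isTree, hx.injOn, hx.adj, fun i hi hih w hw => ?_, by omega, le_rfl, by omega⟩
    refine hx.nbr (by omega) (hT.degree_le_two _ ?_) h0 hw
    rw [← hxh]
    exact hx.ne_of_ne (by omega) (by omega) hih
  have hne : x (h + 1) ≠ r := by
    rw [← hxh]
    exact hx.ne_of_ne (by omega) (by omega) (by omega)
  refine ⟨shift T x h 1, x (h + 1), ⟨hS.isTree_shift, fun w hw => ?_⟩, ?_, hS.numLeaves_shift,
    hS.spectralMoment_le, ?_⟩
  · by_cases hwr : w = x h
    · rw [hwr, hS.degree_shift_start]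
    · rw [hS.degree_shift_of_ne hwr hw]
      exact hT.degree_le_two w (hxh ▸ hwr)
  · have h1 := hS.degree_shift_end
    have h2 := hS.two_le_degree (i := h + 1) (by omega) (by omega)
    rw [hxh] at h1
    omega
  · let ix := Function.invFunOn x (Set.Iic N)
    have hix : ∀ i ≤ N, ix (x i) = i := fun i hi => hx.injOn.leftInvOn_invFunOn hi
    let S : Finset V := (Finset.range (N + 1)).image x
    have hmemS : ∀ w, w ∈ S ↔ ∃ i ≤ N, x i = w := by
      intro w
      simp [S]
    -- The expected distance from the new centre: `|i - (h + 1)|` on the path, unchanged off it.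
    -- Only the upper bound is needed, so descent along `f` suffices.
    let f : V → ℕ := fun w => if w ∈ S then (ix w - (h + 1)) + (h + 1 - ix w) else T.dist r w
    have hfx : ∀ i ≤ N, f (x i) = (i - (h + 1)) + (h + 1 - i) := by
      intro i hi
      have : x i ∈ S := (hmemS _).2 ⟨i, hi, rfl⟩
      simp only [f, this, if_true, hix i hi]
    have hadj : ∀ i < N, (shift T x h 1).Adj (x i) (x (i + 1)) :=
      fun i hi => Or.inl (hS.adj_shiftBase hi)
    have hle : ∀ w, (shift T x h 1).dist (x (h + 1)) w ≤ f w := by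
      refine dist_le_of_descent hS.isTree_shift.connected f fun w hw => ?_
      by_cases hwS : w ∈ S
      · obtain ⟨i, hi, rfl⟩ := (hmemS w).1 hwS
        rw [hfx i hi]
        rcases lt_trichotomy i (h + 1) with h1 | h1 | h1
        · refine ⟨x (i + 1), hadj i (by omega), ?_⟩
          rw [hfx (i + 1) (by omega)]
          omega
        · exact absurd (by rw [h1]) hw
        · have := hadj (i - 1) (by omega)
          rw [show i - 1 + 1 = i by omega] at this
          refine ⟨x (i - 1), this.symm, ?_⟩
          rw [hfx (i - 1) (by omega)]
          omega
      · have hwx : ∀ i ≤ N, w ≠ x i := fun i hi he => hwS ((hmemS w).2 ⟨i, hi, he.symm⟩)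
        have hfw : f w = T.dist r w := by simp only [f, hwS, if_false]
        have hwr : w ≠ r := hxh ▸ hwx h hhN
        obtain ⟨p, hp, hpd⟩ := exists_adj_dist_add_one hT.isTree hwr
        by_cases hpS : p ∈ S
        · obtain ⟨i, hi, rfl⟩ := (hmemS p).1 hpS
          have hih : i = h := by
            by_contra hih
            have hir : x i ≠ r := by
              rw [← hxh]
              exact hx.ne_of_ne hi hhN hih
            rcases lt_or_eq_of_le hi with h1 | h1
            · obtain ⟨j, hj, h2, -⟩ := hx.nbr h1 (hT.degree_le_two _ hir) h0 hp.symm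
              exact hwx j hj h2
            · have := hy w (Finset.mem_univ w)
              rw [h1, hxN] at hpd
              omega
          subst hih
          refine ⟨x (i + 1), Or.inr (Or.inr ⟨rfl, ?_, hwx _ (by omega)⟩), ?_⟩
          · rw [mem_shiftSet]
            exact ⟨hp.symm, hwx _ (by omega), hwx _ (by omega)⟩
          · rw [hfx _ (by omega), hfw]
            omega
        · refine ⟨p, Or.inl ⟨hp, fun h1 => hwx h hhN h1.1, fun h1 => ?_⟩, ?_⟩
          · exact hpS ((hmemS p).2 ⟨h, hhN, h1.1.symm⟩)
          · rw [hfw]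
            simp only [f, hpS, if_false]
            omega
    refine (Finset.sum_le_sum fun w _ => hle w).trans_lt ?_
    have hsplit : ∀ g : V → ℕ, ∑ w, g w = ∑ i ∈ Finset.range (N + 1), g (x i) + ∑ w ∈ Sᶜ, g w := by
      intro g
      rw [← Finset.sum_add_sum_compl S]
      congr 1
      refine Finset.sum_image fun i hi j hj hij => hx.injOn ?_ ?_ hij
      · simpa [Nat.lt_succ_iff] using hi
      · simpa [Nat.lt_succ_iff] using hj
    rw [hsplit f, hsplit (T.dist r)]
    have h1 : ∑ w ∈ Sᶜ, f w = ∑ w ∈ Sᶜ, T.dist r w := by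
      refine Finset.sum_congr rfl fun w hw => ?_
      rw [Finset.mem_compl] at hw
      simp only [f, hw, if_false]
    -- The loss is `h + 1`, the gain `N - h ≥ h + 2`, hence a strict decrease.
    have h2 := sum_dist_shift h (N + 1)
    have h3 : ∀ i ∈ Finset.range (N + 1), i ≤ N := fun i hi => by
      rw [Finset.mem_range] at hi
      omega
    rw [← Finset.sum_congr rfl fun i hi => hfx i (h3 i hi),
      ← Finset.sum_congr rfl fun i hi => hdist i (h3 i hi)] at h2
    rw [h1]
    omega

theorem IsSpider.exists_isBalancedSpider {T : SimpleGraph V} {r : V} (hT : IsSpider T r)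
    (hr : 2 ≤ T.degree r) : ∃ (T' : SimpleGraph V) (r' : V), IsBalancedSpider T' r' ∧
      2 ≤ T'.degree r' ∧ numLeaves T' = numLeaves T ∧ ∀ k, spectralMoment k T ≤ spectralMoment k T' := by
  induction hn : ∑ w, T.dist r w using Nat.strong_induction_on generalizing T r with
  | _ n ih =>
    by_cases hb : IsBalancedSpider T r
    · exact ⟨T, r, hb, hr, rfl, fun _ => le_rfl⟩
    · obtain ⟨T₁, r₁, h1, h2, h3, h4, h5⟩ := hT.exists_balance hr hb
      obtain ⟨T', r', h6, hd, h7, h8⟩ := ih _ (hn ▸ h5) h1 h2 rfl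
      exact ⟨T', r', h6, hd, h7.trans h3, fun k => (h4 k).trans (h8 k)⟩

theorem exists_isBalancedSpider {T : SimpleGraph V} (hT : T.IsTree) (hV : 3 ≤ Fintype.card V) :
    ∃ (T' : SimpleGraph V) (r : V), IsBalancedSpider T' r ∧
      2 ≤ T'.degree r ∧ numLeaves T' = numLeaves T ∧ ∀ k, spectralMoment k T ≤ spectralMoment k T' := by
  obtain ⟨T₁, h1, h2, h3, h4⟩ := exists_subsingleton_branching T hT
  obtain ⟨r, h5, h6⟩ := exists_isSpider h1 hV h4
  obtain ⟨T', r', h7, hd, h8, h9⟩ := h5.exists_isBalancedSpider h6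
  exact ⟨T', r', h7, hd, h8.trans h2, fun k => (h3 k).trans (h9 k)⟩

end Balancing

/-! ### Numbering the vertices of a balanced spider; uniqueness -/

section LegIndex

open scoped Classical

variable {V : Type*} [Fintype V]

theorem image_eq_range_of_lower {α : Type*} (S : Finset α) (f : α → ℕ) (hf : Set.InjOn f S)
    (h : ∀ x ∈ S, ∀ k < f x, ∃ y ∈ S, f y = k) : S.image f = Finset.range S.card := by
  have hc : (S.image f).card = S.card := Finset.card_image_of_injOn hf
  refine (Finset.eq_of_subset_of_card_le (fun k hk => ?_) (by simp [hc])).symm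
  by_contra hcon
  have hsub : S.image f ⊆ Finset.range k := by
    intro l hl
    obtain ⟨x, hx, rfl⟩ := Finset.mem_image.1 hl
    rw [Finset.mem_range]
    by_contra hlt
    rcases eq_or_lt_of_le (not_lt.1 hlt) with h1 | h1
    · exact hcon (h1 ▸ hl)
    · obtain ⟨y, hy, h2⟩ := h x hx k h1
      exact hcon (Finset.mem_image.2 ⟨y, hy, h2⟩)
  have := Finset.card_le_card hsub
  rw [hc, Finset.card_range] at this
  rw [Finset.mem_range] at hk
  omega

theorem exists_antitone_enumeration {α : Type*} (S : Finset α) (f : α → ℕ) :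
    ∃ e : α → ℕ, Set.InjOn e S ∧ (∀ x ∈ S, e x < S.card) ∧ (∀ j < S.card, ∃ x ∈ S, e x = j) ∧
      ∀ x ∈ S, ∀ y ∈ S, f y < f x → e x < e y := by
  induction S using Finset.induction_on_min_value f with
  | empty => exact ⟨fun _ => 0, by simp, by simp, by simp, by simp⟩
  | insert a s ha hle ih =>
    obtain ⟨e, h1, h2, h3, h4⟩ := ih
    have hne : ∀ x ∈ s, x ≠ a := fun x hx he => ha (he ▸ hx)
    have hs : ∀ x ∈ s, Function.update e a s.card x = e x := fun x hx =>
      Function.update_of_ne (hne x hx) _ _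
    refine ⟨Function.update e a s.card, ?_, ?_, ?_, ?_⟩
    · intro x hx y hy hxy
      rw [Finset.mem_coe, Finset.mem_insert] at hx hy
      rcases hx with rfl | hx <;> rcases hy with rfl | hy
      · rfl
      · rw [hs y hy, Function.update_self] at hxy
        exact absurd hxy (h2 y hy).ne'
      · rw [hs x hx, Function.update_self] at hxy
        exact absurd hxy (h2 x hx).ne
      · rw [hs x hx, hs y hy] at hxy
        exact h1 hx hy hxy
    · intro x hx
      rw [Finset.card_insert_of_notMem ha]
      rcases Finset.mem_insert.1 hx with rfl | hx
      · simp
      · rw [hs x hx]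
        exact (h2 x hx).trans (Nat.lt_succ_self _)
    · intro j hj
      rw [Finset.card_insert_of_notMem ha] at hj
      rcases Nat.lt_succ_iff_lt_or_eq.1 hj with hj | rfl
      · obtain ⟨x, hx, rfl⟩ := h3 j hj
        exact ⟨x, Finset.mem_insert_of_mem hx, hs x hx⟩
      · exact ⟨a, Finset.mem_insert_self _ _, by simp⟩
    · intro x hx y hy hlt
      rcases Finset.mem_insert.1 hx with rfl | hx' <;>
        rcases Finset.mem_insert.1 hy with rfl | hy'
      · exact absurd hlt (lt_irrefl _)
      · have := hle y hy'
        omega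
      · rw [hs x hx', Function.update_self]
        exact h2 x hx'
      · rw [hs x hx', hs y hy']
        exact h4 x hx' y hy' hlt

/-- The ancestor is the neighbour of `r` beneath which a vertex lies, reached by iterating the
parent map. -/
theorem exists_ancestor {T : SimpleGraph V} (hT : T.IsTree) (r : V) : ∃ anc : V → V,
    (∀ w, T.dist r w = 1 → anc w = w) ∧
    ∀ v w, T.Adj v w → T.dist r w = T.dist r v + 1 → v ≠ r → anc w = anc v := by
  have hpar : ∀ w, ∃ p, w ≠ r → T.Adj w p ∧ T.dist r p + 1 = T.dist r w := by
    intro w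
    by_cases hw : w = r
    · exact ⟨r, fun h => absurd hw h⟩
    · obtain ⟨p, hp⟩ := exists_adj_dist_add_one hT hw
      exact ⟨p, fun _ => hp⟩
  choose par hpar using hpar
  refine ⟨fun w => par^[T.dist r w - 1] w, fun w hw => by simp [hw], fun v w hvw hd hv => ?_⟩
  have hw : w ≠ r := by
    rintro rfl
    simp at hd
  obtain ⟨h1, h2⟩ := hpar w hw
  have h3 : par w = v := eq_of_adj_of_dist_lt hT (r := r) h1 hvw.symm (by omega) (by omega)
  have h4 := hT.connected.pos_dist_of_ne hv.symm
  show par^[T.dist r w - 1] w = par^[T.dist r v - 1] v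
  rw [show T.dist r w - 1 = T.dist r v - 1 + 1 by omega, Function.iterate_succ_apply, h3]

/-- `idx` numbers the legs of the balanced spider `T` with centre `r`, the longer legs first; every
vertex carries the number of its leg. -/
structure IsLegIndex (T : SimpleGraph V) (r : V) (idx : V → ℕ) : Prop extends
    IsBalancedSpider T r where
  centre : idx r = 0
  lt_degree : ∀ w, w ≠ r → idx w < T.degree r
  inj : ∀ v w, T.dist r v = T.dist r w → idx v = idx w → v = w
  of_adj : ∀ v w, T.Adj v w → T.dist r w = T.dist r v + 1 → v ≠ r → idx w = idx v
  exists_of_lt : ∀ w, ∀ j < idx w, ∃ v, T.dist r v = T.dist r w ∧ idx v = j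
  exists_of_two_le : ∀ w, 2 ≤ T.dist r w → ∀ j < T.degree r,
    ∃ v, T.dist r v + 1 = T.dist r w ∧ idx v = j

/-- Legs correspond to neighbours of the centre and are ranked by the distance of their tips.
Balance forces every leg to reach at least the last level but one. -/
theorem IsBalancedSpider.exists_isLegIndex {T : SimpleGraph V} {r : V}
    (hT : IsBalancedSpider T r) : ∃ idx : V → ℕ, IsLegIndex T r idx := by
  have hc := hT.isTree.connected
  obtain ⟨anc, ha1, ha2⟩ := exists_ancestor hT.isTree r
  have hr : ∀ w, w ≠ r ↔ 1 ≤ T.dist r w := by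
    intro w
    rw [← not_iff_not, not_not, eq_comm, ← hc.dist_eq_zero_iff]
    omega
  have hanc : ∀ w, w ≠ r → anc w ∈ T.neighborFinset r := by
    intro w hw
    induction hd : T.dist r w generalizing w with
    | zero => exact absurd hd (by have := (hr w).1 hw; omega)
    | succ d ih =>
      obtain ⟨p, hp, hpd⟩ := exists_adj_dist_add_one hT.isTree hw
      by_cases hpr : p = r
      · subst hpr
        rw [SimpleGraph.dist_self] at hpd
        rw [ha1 w hpd.symm, SimpleGraph.mem_neighborFinset]
        exact hp.symm
      · rw [ha2 p w hp.symm hpd.symm hpr]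
        exact ih p hpr (by omega)
  have hinj : ∀ v w, v ≠ r → T.dist r v = T.dist r w → anc v = anc w → v = w := by
    intro v w hv hvw h
    induction hd : T.dist r v generalizing v w with
    | zero => exact absurd hd (by have := (hr v).1 hv; omega)
    | succ d ih =>
      have hw : w ≠ r := by rw [hr] at hv ⊢; omega
      obtain ⟨p, hp, hpd⟩ := exists_adj_dist_add_one hT.isTree hv
      obtain ⟨q, hq, hqd⟩ := exists_adj_dist_add_one hT.isTree hw
      by_cases hd0 : d = 0
      · rw [← ha1 v (by omega), ← ha1 w (by omega), h]
      have hpr : p ≠ r := by rw [hr]; omega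
      have hqr : q ≠ r := by rw [hr]; omega
      have hpq : p = q := ih p q hpr (by omega)
        (by rw [← ha2 p v hp.symm hpd.symm hpr, h, ha2 q w hq.symm hqd.symm hqr]) (by omega)
      subst hpq
      obtain ⟨g, hg, hgd⟩ := exists_adj_dist_add_one hT.isTree hpr
      have hgv : g ≠ v := by rintro rfl; omega
      rcases eq_or_eq_of_degree_le_two (hT.degree_le_two p hpr) hg hp.symm hgv hq.symm with h1 | h1
      · subst h1
        omega
      · exact h1.symm
  have hpre : ∀ w j, 1 ≤ j → j ≤ T.dist r w → ∃ v, T.dist r v = j ∧ anc v = anc w := by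
    intro w j hj1 hj
    induction hd : T.dist r w generalizing w with
    | zero => omega
    | succ d ih =>
      rcases eq_or_lt_of_le hj with h1 | h1
      · exact ⟨w, h1.symm, rfl⟩
      · obtain ⟨p, hp, hpd⟩ := exists_adj_dist_add_one hT.isTree ((hr w).2 (by omega))
        have hpr : p ≠ r := by rw [hr]; omega
        obtain ⟨v, hv, hv2⟩ := ih p (by omega) (by omega)
        exact ⟨v, hv, hv2.trans (ha2 p w hp.symm hpd.symm hpr).symm⟩
  have htip : ∀ c, ∃ t, c ∈ T.neighborFinset r →
      t ≠ r ∧ anc t = c ∧ ∀ w, w ≠ r → anc w = c → T.dist r w ≤ T.dist r t := by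
    intro c
    by_cases hcr : c ∈ T.neighborFinset r
    · have hc1 : T.dist r c = 1 := by
        rw [SimpleGraph.mem_neighborFinset] at hcr
        exact SimpleGraph.dist_eq_one_iff_adj.2 hcr
      obtain ⟨t, ht, hmax⟩ := Finset.exists_max_image
        (Finset.univ.filter fun w => w ≠ r ∧ anc w = c) (fun w => T.dist r w)
        ⟨c, by simp [ha1 c hc1, hr, hc1]⟩
      simp only [Finset.mem_filter, Finset.mem_univ, true_and] at ht hmax
      exact ⟨t, fun _ => ⟨ht.1, ht.2, fun w h1 h2 => hmax w ⟨h1, h2⟩⟩⟩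
    · exact ⟨r, fun h => absurd h hcr⟩
  choose tip htip using htip
  obtain ⟨e, he1, he2, he3, he4⟩ := exists_antitone_enumeration (T.neighborFinset r)
    (fun c => T.dist r (tip c))
  rw [SimpleGraph.card_neighborFinset_eq_degree] at he2 he3
  have hidx : ∀ w, w ≠ r → (if w = r then 0 else e (anc w)) = e (anc w) := fun w hw => if_neg hw
  refine ⟨fun w => if w = r then 0 else e (anc w), hT, by simp, fun w hw => ?_,
    fun v w hd h => ?_, fun v w hvw hd hv => ?_, fun w j hj => ?_, fun w hw j hj => ?_⟩
  · rw [hidx w hw]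
    exact he2 _ (hanc w hw)
  · by_cases hv : v = r
    · by_contra hvw
      have := (hr w).1 (by rintro rfl; exact hvw hv)
      rw [hv, SimpleGraph.dist_self] at hd
      omega
    · have hw : w ≠ r := by rw [← ne_eq, hr] at hv; rw [hr]; omega
      rw [hidx v hv, hidx w hw] at h
      exact hinj v w hv hd (he1 (hanc v hv) (hanc w hw) h)
  · have hw : w ≠ r := by rw [hr]; omega
    rw [hidx v hv, hidx w hw, ha2 v w hvw hd hv]
  · by_cases hw : w = r
    · simp [hw] at hj
    · rw [hidx w hw] at hj
      have hcw := hanc w hw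
      obtain ⟨c, hcn, rfl⟩ := he3 j (hj.trans (he2 _ hcw))
      obtain ⟨h1, h2, -⟩ := htip c hcn
      have h3 : T.dist r w ≤ T.dist r (tip c) := by
        refine ((htip _ hcw).2.2 w hw rfl).trans ?_
        by_contra hcon
        have := he4 _ hcw _ hcn (not_le.1 hcon)
        omega
      obtain ⟨v, hv1, hv2⟩ := hpre (tip c) (T.dist r w) ((hr w).1 hw) h3
      have hv : v ≠ r := (hr v).2 (hv1 ▸ (hr w).1 hw)
      exact ⟨v, hv1, by rw [hidx v hv, hv2, h2]⟩
  · obtain ⟨c, hcn, rfl⟩ := he3 j hj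
    obtain ⟨h1, h2, h3⟩ := htip c hcn
    -- A leg ending two levels too early has a leaf at its tip, while the next level holds a vertex
    -- `p` with both a parent and a child, against the monotonicity of degrees.
    have h4 : T.dist r w - 1 ≤ T.dist r (tip c) := by
      by_contra hcon
      have hdt : T.degree (tip c) ≤ 1 := by
        by_contra hcon2
        obtain ⟨y, hy, hyd⟩ := exists_child hT.isTree r (w := tip c) (by omega)
        have := h3 y (by rw [hr]; omega) ((ha2 _ y hy hyd h1).trans h2)
        omega
      obtain ⟨z, hz, -⟩ := hpre w (T.dist r (tip c) + 2) (by omega) (by omega)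
      obtain ⟨p, hp, hpd⟩ := exists_adj_dist_add_one hT.isTree (r := r) (w := z) (by rw [hr]; omega)
      obtain ⟨q, hq, hqd⟩ := exists_adj_dist_add_one hT.isTree (r := r) (w := p) (by rw [hr]; omega)
      have h5 := two_le_degree_of_adj hp.symm hq (by rintro rfl; omega)
      have h6 := hT.degree_le (tip c) p (by omega)
      omega
    obtain ⟨v, hv1, hv2⟩ := hpre (tip c) (T.dist r w - 1) (by omega) h4
    have hv : v ≠ r := by rw [hr]; omega
    exact ⟨v, by omega, by rw [hidx v hv, hv2, h2]⟩

namespace IsLegIndex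

variable {T : SimpleGraph V} {r : V} {idx : V → ℕ} (h : IsLegIndex T r idx)

include h

theorem ne_iff {w : V} : w ≠ r ↔ 1 ≤ T.dist r w := by
  rw [← not_iff_not, not_not, eq_comm, ← h.isTree.connected.dist_eq_zero_iff]
  omega

theorem adj_iff {v w : V} (hd : T.dist r w = T.dist r v + 1) :
    T.Adj v w ↔ v = r ∨ idx w = idx v := by
  constructor
  · intro hvw
    by_cases hv : v = r
    · exact Or.inl hv
    · exact Or.inr (h.of_adj v w hvw hd hv)
  · intro hvw
    obtain ⟨p, hp, hpd⟩ := exists_adj_dist_add_one h.isTree (h.ne_iff.2 (by omega : 1 ≤ T.dist r w))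
    suffices hpv : p = v by
      rw [← hpv]
      exact hp.symm
    by_cases hv : v = r
    · subst hv
      rw [SimpleGraph.dist_self] at hd
      exact (h.isTree.connected.dist_eq_zero_iff.1 (by omega)).symm
    · have hpr : p ≠ r := by
        have := h.ne_iff.1 hv
        exact h.ne_iff.2 (by omega)
      refine h.inj p v (by omega) ?_
      rw [← h.of_adj p w hp.symm hpd.symm hpr]
      exact hvw.resolve_left hv

/-- The number of `w` when the vertices are listed by distance from the centre and, at equal distance,
by leg. -/
noncomputable def number (T : SimpleGraph V) (r : V) (idx : V → ℕ) (w : V) : ℕ :=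
  if w = r then 0 else (T.dist r w - 1) * T.degree r + idx w + 1

omit h in
theorem number_centre : number T r idx r = 0 := if_pos rfl

omit h in
theorem number_of_ne {w : V} (hw : w ≠ r) :
    number T r idx w = (T.dist r w - 1) * T.degree r + idx w + 1 := if_neg hw

/-- Level and leg are the quotient and remainder on division by the degree of the centre. -/
theorem number_injective : Function.Injective (number T r idx) := by
  intro v w hvw
  by_cases hv : v = r <;> by_cases hw : w = r
  · rw [hv, hw]
  · rw [hv, number_centre, number_of_ne hw] at hvw
    omega
  · rw [hw, number_centre, number_of_ne hv] at hvw
    omega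
  · rw [number_of_ne hv, number_of_ne hw] at hvw
    have h1 := h.lt_degree v hv
    have h2 := h.lt_degree w hw
    have h3 : T.dist r v - 1 = T.dist r w - 1 ∧ idx v = idx w := by
      have hpos : 0 < T.degree r := by omega
      have e1 := congrArg (· / T.degree r) (Nat.succ_injective hvw)
      simp only [mul_comm _ (T.degree r), Nat.mul_add_div hpos, Nat.div_eq_of_lt h1,
        Nat.div_eq_of_lt h2, add_zero] at e1
      rw [e1] at hvw
      exact ⟨e1, by omega⟩
    have h4 := h.ne_iff.1 hv
    have h5 := h.ne_iff.1 hw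
    exact h.inj v w (by omega) h3.2

theorem exists_number_eq {w : V} {k : ℕ} (hw : number T r idx w = k + 1) :
    ∃ v, number T r idx v = k := by
  have hwr : w ≠ r := by
    rintro rfl
    rw [number_centre] at hw
    omega
  rw [number_of_ne hwr] at hw
  have hd := h.ne_iff.1 hwr
  rcases Nat.eq_zero_or_pos (idx w) with h0 | hpos
  · by_cases h1 : T.dist r w = 1
    · refine ⟨r, ?_⟩
      rw [number_centre]
      rw [h1, h0] at hw
      omega
    · have h2 := h.lt_degree w hwr
      obtain ⟨v, hv, hvi⟩ := h.exists_of_two_le w (by omega) (T.degree r - 1) (by omega)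
      refine ⟨v, ?_⟩
      rw [number_of_ne (h.ne_iff.2 (by omega : 1 ≤ T.dist r v)), hvi]
      have h3 : T.dist r w - 1 = (T.dist r v - 1) + 1 := by omega
      rw [h3, h0, Nat.add_mul] at hw
      omega
  · obtain ⟨v, hv, hvi⟩ := h.exists_of_lt w (idx w - 1) (by omega)
    refine ⟨v, ?_⟩
    rw [number_of_ne (h.ne_iff.2 (by omega : 1 ≤ T.dist r v)), hvi, hv]
    omega

theorem image_number : Finset.univ.image (number T r idx) = Finset.range (Fintype.card V) := by
  refine image_eq_range_of_lower _ _ h.number_injective.injOn fun w _ k hk => ?_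
  obtain ⟨l, hl⟩ := Nat.exists_eq_add_of_lt hk
  induction l generalizing k with
  | zero =>
    obtain ⟨v, hv⟩ := h.exists_number_eq hl
    exact ⟨v, Finset.mem_univ _, hv⟩
  | succ l ih =>
    obtain ⟨v, -, hv⟩ := ih (k + 1) (by omega) (by omega)
    obtain ⟨u, hu⟩ := h.exists_number_eq hv
    exact ⟨u, Finset.mem_univ _, hu⟩

/-- The parent relation is read off from the numbers and the degree of the centre alone, which is
why balanced spiders are unique. -/
theorem adj_and_dist_iff {v w : V} : T.Adj v w ∧ T.dist r w = T.dist r v + 1 ↔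
    (number T r idx v = 0 ∧ 1 ≤ number T r idx w ∧ number T r idx w ≤ T.degree r) ∨
      (1 ≤ number T r idx v ∧ number T r idx w = number T r idx v + T.degree r) := by
  constructor
  · rintro ⟨hvw, hd⟩
    have hw : w ≠ r := h.ne_iff.2 (by omega)
    by_cases hv : v = r
    · subst hv
      left
      rw [SimpleGraph.dist_self] at hd
      have := h.lt_degree w hw
      rw [number_centre, number_of_ne hw, hd]
      simp
      omega
    · right
      rw [number_of_ne hv, number_of_ne hw, h.of_adj v w hvw hd hv]
      have := h.ne_iff.1 hv
      rw [show T.dist r w - 1 = (T.dist r v - 1) + 1 by omega, Nat.add_mul]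
      omega
  · intro hn
    by_cases hv : v = r
    · subst hv
      rw [number_centre] at hn
      have hw : w ≠ v := by
        rintro rfl
        rw [number_centre] at hn
        omega
      rw [number_of_ne hw] at hn
      have h1 := h.ne_iff.1 hw
      have h2 : T.dist v w = 1 := by
        by_contra hcon
        have h3 : 1 * T.degree v ≤ (T.dist v w - 1) * T.degree v :=
          Nat.mul_le_mul_right _ (by omega)
        omega
      rw [SimpleGraph.dist_self]
      exact ⟨SimpleGraph.dist_eq_one_iff_adj.1 h2, h2⟩
    · have hw : w ≠ r := by
        rintro rfl
        rw [number_centre, number_of_ne hv] at hn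
        omega
      have h1 := h.ne_iff.1 hw
      have h2 := h.ne_iff.1 hv
      have h3 := h.lt_degree v hv
      have h4 := h.lt_degree w hw
      rw [number_of_ne hv, number_of_ne hw] at hn
      have h5 : (T.dist r w - 1) * T.degree r + idx w = T.dist r v * T.degree r + idx v := by
        have : T.dist r v * T.degree r = (T.dist r v - 1) * T.degree r + T.degree r := by
          conv_lhs => rw [show T.dist r v = (T.dist r v - 1) + 1 by omega, Nat.add_mul, one_mul]
        omega
      have hpos : 0 < T.degree r := by omega
      have e1 := congrArg (· / T.degree r) h5
      simp only [mul_comm _ (T.degree r), Nat.mul_add_div hpos, Nat.div_eq_of_lt h3,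
        Nat.div_eq_of_lt h4, add_zero] at e1
      rw [e1] at h5
      have hd : T.dist r w = T.dist r v + 1 := by omega
      exact ⟨(h.adj_iff hd).2 (Or.inr (by omega)), hd⟩

end IsLegIndex

theorem IsLegIndex.nonempty_iso {W : Type*} [Fintype W] {T : SimpleGraph V} {r : V} {idx : V → ℕ}
    (h : IsLegIndex T r idx) {G : SimpleGraph W} {q : W} {idx' : W → ℕ} (h' : IsLegIndex G q idx')
    (hcard : Fintype.card V = Fintype.card W) (hdeg : T.degree r = G.degree q) :
    Nonempty (T ≃g G) := by
  have hex : ∀ v, ∃ w, IsLegIndex.number G q idx' w = IsLegIndex.number T r idx v := by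
    intro v
    have h1 : IsLegIndex.number T r idx v ∈ Finset.univ.image (IsLegIndex.number T r idx) :=
      Finset.mem_image_of_mem _ (Finset.mem_univ v)
    rw [h.image_number, hcard, ← h'.image_number] at h1
    obtain ⟨w, -, hw⟩ := Finset.mem_image.1 h1
    exact ⟨w, hw⟩
  choose φ hφ using hex
  have hinj : Function.Injective φ := by
    intro v w hvw
    apply h.number_injective
    rw [← hφ, ← hφ, hvw]
  have hbij : Function.Bijective φ := (Fintype.bijective_iff_injective_and_card φ).2 ⟨hinj, hcard⟩
  have key : ∀ v w, T.Adj v w ∧ T.dist r w = T.dist r v + 1 ↔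
      G.Adj (φ v) (φ w) ∧ G.dist q (φ w) = G.dist q (φ v) + 1 := by
    intro v w
    rw [h.adj_and_dist_iff, h'.adj_and_dist_iff, hφ, hφ, hdeg]
  refine ⟨⟨Equiv.ofBijective φ hbij, fun {v w} => ?_⟩⟩
  simp only [Equiv.ofBijective_apply]
  constructor
  · intro hvw
    rcases h'.isTree.dist_eq_dist_add_one_of_adj q hvw with h1 | h1
    · exact ((key w v).2 ⟨hvw.symm, h1⟩).1.symm
    · exact ((key v w).2 ⟨hvw, h1⟩).1
  · intro hvw
    rcases h.isTree.dist_eq_dist_add_one_of_adj r hvw with h1 | h1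
    · exact ((key w v).1 ⟨hvw.symm, h1⟩).1.symm
    · exact ((key v w).1 ⟨hvw, h1⟩).1

end LegIndex

/-! ### Balanced spiders are greedy trees -/

section GreedyLabelling

open scoped Classical

variable {V : Type*} [Fintype V]

theorem mem_level {G : SimpleGraph V} {r v : V} {h : ℕ} : v ∈ level G r h ↔ G.dist r v = h := by
  simp [level]

namespace IsLegIndex

variable {T : SimpleGraph V} {r : V} {idx : V → ℕ} (h : IsLegIndex T r idx)

include h

theorem injOn_level (d : ℕ) : Set.InjOn idx (level T r d) := by
  intro v hv w hw hvw
  rw [Finset.mem_coe, mem_level] at hv hw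
  exact h.inj v w (hv.trans hw.symm) hvw

theorem image_level (d : ℕ) : (level T r d).image idx = Finset.range (level T r d).card := by
  refine image_eq_range_of_lower _ _ (h.injOn_level d) fun w hw k hk => ?_
  obtain ⟨v, hv, hvi⟩ := h.exists_of_lt w k hk
  exact ⟨v, mem_level.2 (hv.trans (mem_level.1 hw)), hvi⟩

theorem card_filter_lt (v : V) :
    ((level T r (T.dist r v)).filter fun u => idx u < idx v).card = idx v := by
  rw [← Finset.card_image_of_injOn ((h.injOn_level _).mono (Finset.filter_subset _ _))]
  conv_rhs => rw [← Finset.card_range (idx v)]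
  congr 1
  ext k
  simp only [Finset.mem_image, Finset.mem_filter, mem_level, Finset.mem_range]
  constructor
  · rintro ⟨u, hu, rfl⟩
    exact hu.2
  · intro hk
    obtain ⟨u, hu, rfl⟩ := h.exists_of_lt v k hk
    exact ⟨u, ⟨hu, hk⟩, rfl⟩

theorem numChildren_eq_zero {v : V} (hv : ¬ ∃ c, T.Adj v c ∧ T.dist r c = T.dist r v + 1) :
    numChildren T r v = 0 := by
  rw [numChildren, Finset.card_eq_zero, Finset.filter_eq_empty_iff]
  exact fun c hc hvc => hv ⟨c, hvc, mem_level.1 hc⟩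

theorem numChildren_eq_one {v : V} (hv : v ≠ r)
    (hc : ∃ c, T.Adj v c ∧ T.dist r c = T.dist r v + 1) : numChildren T r v = 1 := by
  obtain ⟨c, hvc, hcd⟩ := hc
  rw [numChildren, Finset.card_eq_one]
  refine ⟨c, ?_⟩
  ext w
  simp only [Finset.mem_filter, mem_level, Finset.mem_singleton]
  constructor
  · rintro ⟨hwd, hvw⟩
    exact h.inj w c (hwd.trans hcd.symm)
      ((h.of_adj v w hvw hwd hv).trans (h.of_adj v c hvc hcd hv).symm)
  · rintro rfl
    exact ⟨hcd, hvc⟩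

theorem exists_child_of_le {u v : V} (huv : T.dist r u = T.dist r v) (hle : idx u ≤ idx v)
    (hv : v ≠ r) (hc : ∃ c, T.Adj v c ∧ T.dist r c = T.dist r v + 1) :
    ∃ c, T.Adj u c ∧ T.dist r c = T.dist r u + 1 := by
  rcases eq_or_lt_of_le hle with h1 | h1
  · rwa [h.inj u v huv h1]
  · obtain ⟨c, hvc, hcd⟩ := hc
    rw [← h.of_adj v c hvc hcd hv] at h1
    obtain ⟨c', hc', hi⟩ := h.exists_of_lt c _ h1
    have hd : T.dist r c' = T.dist r u + 1 := by omega
    exact ⟨c', (h.adj_iff hd).2 (Or.inr hi), hd⟩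

/-- Away from the centre, the vertices with a child form an initial segment of their level and have
just one child, which inherits their label. -/
theorem isLevelGreedyLabelling : IsLevelGreedyLabelling T r idx where
  isTree := h.isTree
  bijOn d := by
    have him := h.image_level d
    refine ⟨fun v hv => ?_, h.injOn_level d, fun k hk => ?_⟩
    · rw [Set.mem_Iio, ← Finset.mem_range, ← him]
      exact Finset.mem_image_of_mem _ hv
    · rw [Set.mem_Iio, ← Finset.mem_range, ← him, Finset.mem_image] at hk
      exact hk
  degree_antitone u v huv hle := by
    by_cases hv : v = r
    · have : u = v := by
        rw [hv, SimpleGraph.dist_self] at huv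
        rw [hv]
        exact (h.isTree.connected.dist_eq_zero_iff.1 huv).symm
      rw [this]
    · have hu : u ≠ r := h.ne_iff.2 (huv ▸ h.ne_iff.1 hv)
      have h1 := h.degree_le_two v hv
      have h2 := one_le_degree h.isTree hu
      by_contra hcon
      obtain ⟨c, hc, hcd⟩ := h.exists_child_of_le huv hle hv
        (exists_child h.isTree r (by omega))
      obtain ⟨p, hp, hpd⟩ := exists_adj_dist_add_one h.isTree hu
      have := two_le_degree_of_adj hc hp (by rintro rfl; omega)
      omega
  adj_iff v w hd := by
    rw [h.adj_iff hd]
    have hw : w ≠ r := h.ne_iff.2 (by omega)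
    by_cases hv : v = r
    · subst hv
      rw [SimpleGraph.dist_self] at hd
      have h1 : childrenBefore T v idx v = 0 := by
        rw [childrenBefore]
        refine Finset.sum_eq_zero fun u hu => ?_
        rw [Finset.mem_filter, h.centre] at hu
        omega
      have h2 : numChildren T v v = T.degree v := by
        rw [numChildren, ← SimpleGraph.card_neighborFinset_eq_degree]
        congr 1
        ext c
        simp only [Finset.mem_filter, mem_level, SimpleGraph.mem_neighborFinset,
          SimpleGraph.dist_self, zero_add, SimpleGraph.dist_eq_one_iff_adj, and_self]
      have := h.lt_degree w hw
      simp only [h1, h2, true_or, true_iff]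
      omega
    · simp only [hv, false_or]
      by_cases hc : ∃ c, T.Adj v c ∧ T.dist r c = T.dist r v + 1
      · rw [h.numChildren_eq_one hv hc]
        -- As `v` has a child, each of the `idx v` earlier vertices has exactly one.
        have h1 : childrenBefore T r idx v = idx v := by
          rw [childrenBefore]
          refine Eq.trans (Finset.sum_congr rfl fun u hu => ?_)
            ((Finset.card_eq_sum_ones _).symm.trans (h.card_filter_lt v))
          rw [Finset.mem_filter, mem_level] at hu
          exact h.numChildren_eq_one (h.ne_iff.2 (hu.1 ▸ h.ne_iff.1 hv))
            (h.exists_child_of_le hu.1 hu.2.le hv hc)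
        rw [h1]
        omega
      · rw [h.numChildren_eq_zero hc]
        constructor
        · intro hwv
          exact absurd ⟨w, (h.adj_iff hd).2 (Or.inr hwv), hd⟩ hc
        · omega

end IsLegIndex

theorem IsBalancedSpider.isGreedyTree {T : SimpleGraph V} {r : V} (hT : IsBalancedSpider T r) :
    IsGreedyTree T := by
  obtain ⟨idx, h⟩ := hT.exists_isLegIndex
  exact ⟨r, ⟨idx, h.isLevelGreedyLabelling⟩, hT.degree_le⟩

theorem IsBalancedSpider.spectralMoment_eq {T G : SimpleGraph V} {r q : V}
    (hT : IsBalancedSpider T r) (hG : IsBalancedSpider G q) (hdeg : T.degree r = G.degree q)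
    (k : ℕ) : spectralMoment k T = spectralMoment k G := by
  obtain ⟨idx, h⟩ := hT.exists_isLegIndex
  obtain ⟨idx', h'⟩ := hG.exists_isLegIndex
  obtain ⟨e⟩ := h.nonempty_iso h' rfl hdeg
  exact spectralMoment_congr e k

end GreedyLabelling

/-! ### Degree sequences and the conclusion -/

section DegreeSequences

open scoped Classical

variable {V : Type*} [Fintype V]

theorem count_degreeSequence (G : SimpleGraph V) :
    (degreeSequence G).count 1 = numLeaves G := by
  rw [degreeSequence, numLeaves, Multiset.count_map, Finset.card_def, Finset.filter_val]
  simp only [eq_comm]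

theorem degreeSequence_eq_cons (G : SimpleGraph V) (r : V) : degreeSequence G =
    G.degree r ::ₘ (Finset.univ.erase r).val.map fun v => G.degree v := by
  rw [degreeSequence, ← Multiset.map_cons (fun v => G.degree v), Finset.erase_val,
    Multiset.cons_erase (Finset.mem_univ r)]

theorem eq_replicate_add_replicate {M : Multiset ℕ} {a b : ℕ} (hM : ∀ d ∈ M, d = 1 ∨ d = 2)
    (ha : M.card = a + b) (hb : M.count 1 = b) :
    M = Multiset.replicate a 2 + Multiset.replicate b 1 := by
  have h1 : M.filter (fun d => d = 1) = Multiset.replicate b 1 := by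
    rw [Multiset.filter_eq', hb]
  have h2 : M.filter (fun d => ¬ d = 1) = Multiset.replicate a 2 := by
    rw [Multiset.eq_replicate]
    constructor
    · have := congrArg Multiset.card (Multiset.filter_add_not (fun d => d = 1) M)
      rw [Multiset.card_add, h1, Multiset.card_replicate] at this
      omega
    · intro d hd
      rw [Multiset.mem_filter] at hd
      exact (hM d hd.1).resolve_left hd.2
  rw [← h1, ← h2, add_comm]
  exact (Multiset.filter_add_not _ M).symm

theorem coe_leafSequence (n s : ℕ) : (leafSequence n s : Multiset ℕ) =
    s ::ₘ (Multiset.replicate (n - s - 1) 2 + Multiset.replicate s 1) := rfl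

/-- In the degree sum `2n - 2`, every vertex but the centre contributes two, less one if it is a
leaf. -/
theorem IsSpider.card_leaves_erase {T : SimpleGraph V} {r : V} (hT : IsSpider T r) :
    ((Finset.univ.erase r).filter fun v => T.degree v = 1).card = T.degree r := by
  have h1 := (isTree_iff_connected_and_sum_degrees.1 hT.isTree).2
  rw [← Finset.add_sum_erase _ _ (Finset.mem_univ r)] at h1
  have h2 : ∑ v ∈ Finset.univ.erase r, T.degree v +
      ((Finset.univ.erase r).filter fun v => T.degree v = 1).card =
      ∑ _v ∈ Finset.univ.erase r, 2 := by
    rw [Finset.card_filter, ← Finset.sum_add_distrib]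
    refine Finset.sum_congr rfl fun v hv => ?_
    have hvr := Finset.ne_of_mem_erase hv
    have h3 := hT.degree_le_two v hvr
    have h4 := one_le_degree hT.isTree hvr
    split_ifs <;> omega
  rw [Finset.sum_const, Finset.card_erase_of_mem (Finset.mem_univ r), Finset.card_univ,
    smul_eq_mul] at h2
  have h3 : 0 < Fintype.card V := Fintype.card_pos_iff.2 ⟨r⟩
  omega

theorem IsSpider.degree_eq_numLeaves {T : SimpleGraph V} {r : V} (hT : IsSpider T r)
    (hr : T.degree r ≠ 1) : T.degree r = numLeaves T := by
  rw [← hT.card_leaves_erase, numLeaves]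
  congr 1
  ext v
  simp only [Finset.mem_filter, Finset.mem_erase, Finset.mem_univ, and_true, true_and,
    and_iff_right_iff_imp]
  rintro hv rfl
  exact hr hv

theorem IsSpider.degreeSequence_eq {T : SimpleGraph V} {r : V} (hT : IsSpider T r)
    (hlt : T.degree r < Fintype.card V) :
    degreeSequence T = (leafSequence (Fintype.card V) (T.degree r) : Multiset ℕ) := by
  rw [degreeSequence_eq_cons T r, coe_leafSequence]
  congr 1
  refine eq_replicate_add_replicate ?_ ?_ ?_
  · intro d hd
    obtain ⟨v, hv, rfl⟩ := Multiset.mem_map.1 hd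
    have hvr := Finset.ne_of_mem_erase (s := Finset.univ) hv
    have h3 := hT.degree_le_two v hvr
    have h4 := one_le_degree hT.isTree hvr
    omega
  · rw [Multiset.card_map, Finset.card_val, Finset.card_erase_of_mem (Finset.mem_univ r),
      Finset.card_univ]
    omega
  · rw [← hT.card_leaves_erase, Multiset.count_map, Finset.card_def, Finset.filter_val]
    simp only [eq_comm]

/-- Degrees do not increase away from the root, so the root attains the maximum `s`; cancelling that
term leaves only ones and twos for the other vertices. -/
theorem exists_isBalancedSpider_of_isGreedyTree {G : SimpleGraph V} {n s : ℕ} (hs : 2 ≤ s)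
    (hG : IsGreedyTree G) (hseq : degreeSequence G = (leafSequence n s : Multiset ℕ)) :
    ∃ r, IsBalancedSpider G r ∧ G.degree r = s := by
  obtain ⟨r, ⟨pos, hpos⟩, hdeg⟩ := hG
  have hT := hpos.isTree
  have hmax : ∀ w, G.degree w ≤ G.degree r := by
    intro w
    induction hd : G.dist r w generalizing w with
    | zero => rw [hT.connected.dist_eq_zero_iff.1 hd]
    | succ d ih =>
      obtain ⟨p, hp, hpd⟩ := exists_adj_dist_add_one hT (r := r) (w := w) (by
        rintro rfl
        simp at hd)
      exact (hdeg p w hpd.symm).trans (ih p (by omega))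
  have hmem : ∀ d, d ∈ degreeSequence G ↔ ∃ v, G.degree v = d := by
    intro d
    simp [degreeSequence]
  have hle : ∀ d ∈ degreeSequence G, d ≤ s := by
    intro d hd
    rw [hseq, coe_leafSequence, Multiset.mem_cons, Multiset.mem_add] at hd
    rcases hd with rfl | hd | hd
    · exact le_rfl
    · rw [Multiset.eq_of_mem_replicate hd]
      exact hs
    · rw [Multiset.eq_of_mem_replicate hd]
      omega
  have hr : G.degree r = s := by
    obtain ⟨v, hv⟩ := (hmem s).1 (by rw [hseq, coe_leafSequence]; exact Multiset.mem_cons_self _ _)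
    exact le_antisymm (hle _ ((hmem _).2 ⟨r, rfl⟩)) (hv ▸ hmax v)
  refine ⟨r, ⟨⟨hT, fun w hw => ?_⟩, hdeg⟩, hr⟩
  rw [degreeSequence_eq_cons G r, coe_leafSequence, hr, Multiset.cons_inj_right] at hseq
  have h1 : G.degree w ∈ (Finset.univ.erase r).val.map fun v => G.degree v :=
    Multiset.mem_map_of_mem (fun v => G.degree v)
      (Finset.mem_erase.2 ⟨hw, Finset.mem_univ w⟩)
  rw [hseq, Multiset.mem_add] at h1
  rcases h1 with h1 | h1
  · exact (Multiset.eq_of_mem_replicate h1).le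
  · rw [Multiset.eq_of_mem_replicate h1]
    omega

theorem two_le_numLeaves {T : SimpleGraph V} (hT : T.IsTree) (hV : 2 ≤ Fintype.card V) :
    2 ≤ numLeaves T := by
  have : Nontrivial V := Fintype.one_lt_card_iff_nontrivial.1 hV
  obtain ⟨u, v, huv, hu, hv⟩ := hT.exists_ne_and_degree_eq_one
  rw [numLeaves, ← Finset.card_pair huv]
  refine Finset.card_le_card fun w hw => ?_
  simp only [Finset.mem_insert, Finset.mem_singleton] at hw
  rw [Finset.mem_filter]
  rcases hw with rfl | rfl
  · exact ⟨Finset.mem_univ _, hu⟩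
  · exact ⟨Finset.mem_univ _, hv⟩

theorem exists_greedyTree_spectralMoment_le {s : ℕ}
    (hs : s < Fintype.card V) (hne : ∃ T : SimpleGraph V, T.IsTree ∧ numLeaves T = s) :
    (∃ G : SimpleGraph V, IsGreedyTree G ∧
      degreeSequence G = (leafSequence (Fintype.card V) s : Multiset ℕ)) ∧
    ∀ G : SimpleGraph V, IsGreedyTree G →
      degreeSequence G = (leafSequence (Fintype.card V) s : Multiset ℕ) →
      (G.IsTree ∧ numLeaves G = s) ∧
      ∀ T : SimpleGraph V, T.IsTree → numLeaves T = s →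
        ∀ k : ℕ, spectralMoment k T ≤ spectralMoment k G := by
  obtain ⟨T, hT, hTs⟩ := hne
  by_cases hcard : Fintype.card V = 1
  · have hsub : Subsingleton V := Fintype.card_le_one_iff_subsingleton.1 hcard.le
    obtain ⟨r⟩ : Nonempty V := Fintype.card_pos_iff.1 (by omega)
    have hG : ∀ G : SimpleGraph V, G = T := fun G => by
      ext a c
      rw [Subsingleton.elim a c]
      simp
    have hd : ∀ u v : V, T.dist u v = 0 := fun u v => by rw [Subsingleton.elim u v]; simp
    have hb : IsBalancedSpider T r :=
      ⟨⟨hT, fun w hw => absurd (Subsingleton.elim w r) hw⟩, fun u v h => by simp [hd] at h⟩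
    have hdeg : T.degree r = s := by
      have := T.degree_lt_card_verts r
      omega
    refine ⟨⟨T, hb.isGreedyTree, ?_⟩, fun G _ _ => ⟨?_, fun T' _ _ k => ?_⟩⟩
    · rw [← hdeg]
      exact hb.degreeSequence_eq (hdeg ▸ hs)
    · rw [hG G]
      exact ⟨hT, hTs⟩
    · rw [hG G, hG T']
  -- Together with `s < n` this gives `3 ≤ n`, as the construction of a balanced spider requires.
  · have hs2 : 2 ≤ s := hTs ▸ two_le_numLeaves hT (by omega)
    have key : ∀ T : SimpleGraph V, T.IsTree → numLeaves T = s →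
        ∃ (T' : SimpleGraph V) (r : V), IsBalancedSpider T' r ∧ T'.degree r = s ∧
          ∀ k, spectralMoment k T ≤ spectralMoment k T' := by
      intro T hT hTs
      obtain ⟨T', r, h1, h2, h3, h4⟩ := exists_isBalancedSpider hT (by omega)
      refine ⟨T', r, h1, ?_, h4⟩
      rw [← hTs, ← h3]
      exact h1.degree_eq_numLeaves (by omega)
    refine ⟨?_, fun G hG hseq => ?_⟩
    · obtain ⟨T', r, h1, h2, -⟩ := key T hT hTs
      refine ⟨T', h1.isGreedyTree, ?_⟩
      rw [← h2]
      exact h1.degreeSequence_eq (h2.trans_lt hs)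
    · obtain ⟨r, hb, hr⟩ := exists_isBalancedSpider_of_isGreedyTree hs2 hG hseq
      refine ⟨⟨hb.isTree, ?_⟩, fun T hT hTs k => ?_⟩
      · rw [← count_degreeSequence, hseq, coe_leafSequence]
        rw [Multiset.count_cons_of_ne (by omega), Multiset.count_add, Multiset.count_replicate,
          Multiset.count_replicate]
        simp
      · obtain ⟨T', r', h1, h2, h3⟩ := key T hT hTs
        exact (h3 k).trans_eq (h1.spectralMoment_eq hb (h2.trans hr.symm) k)

end DegreeSequences

end GreedyTrees

theorem mainTheorem10 (n s : ℕ) (hsn : s < n)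
    (hne : ∃ T : SimpleGraph (Fin n), T.IsTree ∧ GreedyTrees.numLeaves T = s) :
    (∃ G : SimpleGraph (Fin n), GreedyTrees.IsGreedyTree G ∧
      GreedyTrees.degreeSequence G = (GreedyTrees.leafSequence n s : Multiset ℕ)) ∧
    ∀ G : SimpleGraph (Fin n), GreedyTrees.IsGreedyTree G →
      GreedyTrees.degreeSequence G = (GreedyTrees.leafSequence n s : Multiset ℕ) →
      (G.IsTree ∧ GreedyTrees.numLeaves G = s) ∧
      ∀ T : SimpleGraph (Fin n), T.IsTree → GreedyTrees.numLeaves T = s →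
        ∀ k : ℕ, GreedyTrees.spectralMoment k T ≤ GreedyTrees.spectralMoment k G := by
  have h := GreedyTrees.exists_greedyTree_spectralMoment_le (V := Fin n) (s := s)
    (by rwa [Fintype.card_fin]) hne
  rwa [Fintype.card_fin] at h
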